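/- Let $q$ be an even prime power, $t\ge 0$ an integer, $m=4t+2$ and $n=q^m+1$. For $0\le s\le n-1$ let $C_s=\{sq^i \bmod n : 0\le i\le l-1\}$, where $l=\mathrm{ord}_n(q)$, be the $q$-cyclotomic coset of $s$ modulo $n$, with elements taken in $\{0,\dots,n-1\}$; its smallest element is called a coset leader modulo $n$ (so $0$ is the coset leader of $C_0$). Let $\delta_{i,n}$ denote the $i$-th largest coset leader modulo $n$, when it exists (only $\delta_{3,n}$ can fail to exist, namely for $q=m=2$; the statements that involve it are then void). Let $\beta$ be a primitive $n$-th root of unity in an extension field of $\mathbb F_q$, and let $m_i(x)$ be the minimal polynomial of $\beta^i$ over $\mathbb F_q$. For integers $b\ge 0$ and $\delta\ge 1$ let $\mathcal C_{(n,q,\delta,b)}\subseteq\mathbb F_q^n$ be the cyclic code generated, in $\mathbb F_q[x]/\langle x^n-1\rangle$, by $\mathrm{lcm}\big(m_b(x),m_{b+1}(x),\dots,m_{b+\delta-2}(x)\big)$ (which is $1$ for $\delta=1$). A linear code $\mathcal C$ is LCD if it meets its Euclidean dual only in $0$; it has parameters $[n,k,\ge d]$ if it has length $n$, dimension $k$ and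 minimum Hamming distance at least $d$. Then: (1) The code $\mathcal C_{(n,q,\delta,1)}$ is LCD, with parameters $[n,5,\ge\delta_{2,n}]$ for every integer $\delta$ with $\delta_{2,n}+1\le\delta\le\delta_{1,n}$, and $[n,2m+5,\ge\delta_{3,n}]$ for every integer $\delta$ with $\delta_{3,n}+1\le\delta\le\delta_{2,n}$. (2) The code $\mathcal C_{(n,q,\delta+1,0)}$ is LCD, with parameters $[n,4,\ge 2\delta_{2,n}]$ for every integer $\delta$ with $\delta_{2,n}+1\le\delta\le\delta_{1,n}$, and $[n,2m+4,\ge 2\delta_{3,n}]$ for every integer $\delta$ with $\delta_{3,n}+1\le\delta\le\delta_{2,n}$. -/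

import Mathlib

open Polynomial

noncomputable section

namespace BCH

/-- The `q`-cyclotomic coset `C_s = {s q^i mod n : 0 ≤ i ≤ l - 1}`, where `l = ord_n(q)`,
with its elements taken in `{0, …, n - 1}`. -/
def cyclotomicCoset (q n s : ℕ) : Finset ℕ :=
  (Finset.range (orderOf (q : ZMod n))).image fun i => s * q ^ i % n

/-- The least element `CL(s)` of the coset `C_s`. -/
def cosetLeader (q n s : ℕ) : ℕ :=
  sInf (cyclotomicCoset q n s : Set ℕ)

/-- The set of all coset leaders modulo `n`. -/
def minRep (q n : ℕ) : Finset ℕ :=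
  (Finset.range n).image (cosetLeader q n)

/-- `a` is the `i`-th largest coset leader modulo `n` (counting from `i = 1`):
it is a coset leader, and exactly `i - 1` coset leaders are larger. -/
def IsIthLargestCosetLeader (q n i a : ℕ) : Prop :=
  a ∈ minRep q n ∧ ((minRep q n).filter fun b => a < b).card + 1 = i

section Codes

variable {K : Type*} [Field K]

/-- The identification of a vector `(c_0, …, c_{n-1})` with the polynomial
`c_0 + c_1 x + ⋯ + c_{n-1} x^{n-1}`. -/
def vecToPoly (K : Type*) [Field K] (n : ℕ) : (Fin n → K) →ₗ[K] K[X] :=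
  ∑ i : Fin n, (Polynomial.monomial (i : ℕ)) ∘ₗ LinearMap.proj i

/-- The cyclic code of length `n` generated by `g`: the vectors whose class in
`K[x] / ⟨x^n - 1⟩` lies in the ideal generated by the class of `g`. -/
def cyclicCode (n : ℕ) (g : K[X]) : Submodule K (Fin n → K) :=
  ((Ideal.span {Ideal.Quotient.mk (Ideal.span {(X ^ n - 1 : K[X])}) g}).restrictScalars K).comap
    ((Ideal.Quotient.mkₐ K (Ideal.span {(X ^ n - 1 : K[X])})).toLinearMap ∘ₗ vecToPoly K n)

open Classical in
/-- The (monic) least common multiple of the minimal polynomials over `K` of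
`β^b, β^(b+1), …, β^(b+δ-2)`; it is `1` when `δ = 1`. -/
def genPoly (K : Type*) [Field K] {L : Type*} [Field L] [Algebra K L] (β : L) (δ b : ℕ) : K[X] :=
  letI : NormalizedGCDMonoid K[X] := UniqueFactorizationMonoid.toNormalizedGCDMonoid K[X]
  (Finset.Ico b (b + δ - 1)).lcm fun i => minpoly K (β ^ i)

/-- The BCH code `C_(n,q,δ,b)` over the field `K` with `q` elements, with respect to the
primitive `n`-th root of unity `β`. -/
def bchCode (K : Type*) [Field K] {L : Type*} [Field L] [Algebra K L] (β : L) (n δ b : ℕ) :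
    Submodule K (Fin n → K) :=
  cyclicCode n (genPoly K β δ b)

/-- The Euclidean dual of a linear code. -/
def dualCode {n : ℕ} (C : Submodule K (Fin n → K)) : Submodule K (Fin n → K) where
  carrier := {b | ∀ c ∈ C, b ⬝ᵥ c = 0}
  add_mem' := by
    intro a b ha hb c hc
    rw [add_dotProduct, ha c hc, hb c hc, add_zero]
  zero_mem' := fun c _ => zero_dotProduct c
  smul_mem' := by
    intro r a ha c hc
    rw [smul_dotProduct, ha c hc, smul_zero]

/-- A linear code with complementary dual. -/
def IsLCD {n : ℕ} (C : Submodule K (Fin n → K)) : Prop :=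
  C ⊓ dualCode C = ⊥

open Classical in
/-- The minimum Hamming distance between two distinct codewords
(only used for codes of positive dimension). -/
def minDist {n : ℕ} (C : Submodule K (Fin n → K)) : ℕ :=
  sInf {d | ∃ x ∈ C, ∃ y ∈ C, x ≠ y ∧ hammingDist x y = d}

/-- `C` (of length `n`) has parameters `[n, k, ≥ d]`. -/
def HasParams {n : ℕ} (C : Submodule K (Fin n → K)) (k d : ℕ) : Prop :=
  Module.finrank K C = k ∧ d ≤ minDist C

end Codes

end BCH

end

/-! Write q = 2h. Following s q^i mod n reads off the base-q digits of s/n, so comparing residues is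
comparing digit strings lexicographically. Since q^m ≡ -1 modulo n, advancing by m replaces a
residue r by n - r and a digit d by q - 1 - d. A coset leader is a residue that no element of its
orbit undercuts; as orbits are closed under negation, the orbit of a leader a stays in [a, n - a].
For large leaders this forces every digit to be h - 1 or h, and an orbit becomes a binary word b
with b(i + m) = !b(i) that is compared with its shifts and their complements.

The word 0011 repeated is antiperiodic because m ≡ 2 modulo 4, and it yields a leader. A leader at
least as large must again have antiperiod two (`antiperiod_two_of_above`), so the coset of the
largest leader has size 4. For t ≥ 1, `topWord` yields another leader, hence a lower bound for the
second largest one. The word of that second leader lies above `topWord` without having antiperiod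
two, and `Above.period_eq` shows by a parity argument on pairs of bits that its period is 2m. The
second coset thus has size 2m, without the second leader being computed. For t = 0 every nonzero
coset has size 4 = 2m.

On the coding side, the dimension of a cyclic code counts the exponents that are not zeros: the
residues with leader at least δ, plus the residue 0 when b = 1. As -1 is a power of q, zeros are
closed under inversion. This makes the codes LCD, and for b = 0 it doubles the run of consecutive
zeros: the exponents 1 - δ, …, δ - 1 give the BCH bound 2δ. -/

namespace BCH

/-! ### Orbits of multiplication by q as binary digit words -/

/-- `r` is an orbit of multiplication by `2 * h` modulo `n` all of whose base-`2h` digits are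
`h - 1` or `h`, as recorded by `b`. -/
structure OrbitCode (h n : ℤ) (r : ℕ → ℤ) (b : ℕ → Bool) : Prop where
  pos : ∀ i, 0 < r i
  lt : ∀ i, r i < n
  step : ∀ i, r (i + 1) = 2 * h * r i - (h - 1 + if b i then 1 else 0) * n

namespace OrbitCode

variable {h n : ℤ} {r r' : ℕ → ℤ} {b b' : ℕ → Bool}

theorem shift (H : OrbitCode h n r b) (k : ℕ) :
    OrbitCode h n (fun i => r (k + i)) (fun i => b (k + i)) :=
  ⟨fun _ => H.pos _, fun _ => H.lt _, fun i => H.step (k + i)⟩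

theorem compl (H : OrbitCode h n r b) : OrbitCode h n (fun i => n - r i) (fun i => !b i) := by
  refine ⟨fun i => sub_pos.2 (H.lt i), fun i => by linarith [H.pos i], fun i => ?_⟩
  rw [H.step i]
  cases b i <;> simp <;> ring

/-- Lexicographic order decides: at the first difference the smaller digit puts 2h r below h n and
the larger one puts 2h r' above it. Equal digits before it merely rescale the difference. -/
theorem lt_of_first_diff (hh : 0 < h) (j : ℕ) : ∀ {r r' : ℕ → ℤ} {b b' : ℕ → Bool},
    OrbitCode h n r b → OrbitCode h n r' b' → (∀ k < j, b k = b' k) → b j = false →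
    b' j = true → r 0 < r' 0 := by
  induction j with
  | zero =>
    intro r r' b b' H H' _ h0 h1
    have e := H.step 0
    have e' := H'.step 0
    have l := H.lt 1
    have l' := H'.pos 1
    simp only [h0, h1, zero_add] at e e'
    simp at e e'
    nlinarith
  | succ j ih =>
    intro r r' b b' H H' hk h0 h1
    have := ih (H.shift 1) (H'.shift 1)
      (fun k hkj => by rw [add_comm]; exact hk (k + 1) (by omega))
      (by rw [add_comm]; exact h0) (by rw [add_comm]; exact h1)
    have e := H.step 0
    have e' := H'.step 0
    rw [hk 0 (by omega)] at e
    simp only [add_zero, zero_add] at this e e'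
    nlinarith

theorem ext_zero (hh : 0 < h) (H : OrbitCode h n r b) (H' : OrbitCode h n r' b')
    (hb : ∀ i, b i = b' i) : r 0 = r' 0 := by
  have key : ∀ j : ℕ, r j - r' j = (2 * h) ^ j * (r 0 - r' 0) := by
    intro j
    induction j with
    | zero => simp
    | succ j ih =>
      rw [H.step, H'.step, hb, pow_succ]
      linear_combination 2 * h * ih
  by_contra hne
  -- With equal digits the difference is multiplied by 2h at each step. After n steps a nonzero
  -- difference would exceed n, although both orbits stay in (0, n).
  have hpow : ∀ j : ℕ, (j : ℤ) < (2 * h) ^ j := by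
    intro j
    have : (2 : ℤ) ^ j ≤ (2 * h) ^ j := pow_le_pow_left₀ (by norm_num) (by linarith) j
    have h2 : (j : ℤ) < 2 ^ j := by exact_mod_cast Nat.lt_two_pow_self
    linarith
  have hn : 0 < n := (H.pos 0).trans (H.lt 0)
  have hj := hpow n.toNat
  rw [Int.toNat_of_nonneg hn.le] at hj
  have k := key n.toNat
  have a1 := H.pos n.toNat
  have a2 := H.lt n.toNat
  have a3 := H'.pos n.toNat
  have a4 := H'.lt n.toNat
  rcases lt_or_gt_of_ne hne with hlt | hgt
  · nlinarith
  · nlinarith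

theorem congr_seq (hh : 0 < h) (H : OrbitCode h n r b) (H' : OrbitCode h n r' b')
    (hb : ∀ i, b i = b' i) (i : ℕ) : r i = r' i :=
  ext_zero hh (H.shift i) (H'.shift i) fun _ => hb _

theorem bit_iff (hh : 0 < h) (H : OrbitCode h n r b) (i : ℕ) : b i = true ↔ n < 2 * r i := by
  have e := H.step i
  have l := H.lt (i + 1)
  have l' := H.pos (i + 1)
  cases hb : b i <;> simp [hb] at e ⊢ <;> nlinarith

/-- An antiperiodic bit sequence is the code of an orbit modulo `(2 * h) ^ m + 1`. -/
theorem exists_of_antiperiodic (hh : 0 < h) {m : ℕ} (hm : 0 < m) (b : ℕ → Bool)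
    (hb : ∀ i, b (i + m) = !b i) : ∃ r : ℕ → ℤ, OrbitCode h ((2 * h) ^ m + 1) r b := by
  set D : ℕ → ℤ := fun i => h - 1 + if b i then 1 else 0 with hD
  have D0 : ∀ i, 0 ≤ D i := fun i => by
    simp only [hD]; split_ifs <;> linarith
  have D1 : ∀ i, D i ≤ 2 * h - 1 := fun i => by
    simp only [hD]; split_ifs <;> linarith
  have Dm : ∀ i, D (i + m) = 2 * h - 1 - D i := fun i => by
    simp only [hD, hb]; cases b i <;> simp <;> ring
  -- The expansion of period 2m with digit block A followed by its complement q^m - 1 - A has value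
  -- (A + 1)/(q^m + 1), whence the summand 1.
  refine ⟨fun i => 1 + ∑ j ∈ Finset.range m, D (i + j) * (2 * h) ^ (m - 1 - j), ?_, ?_, ?_⟩
  · intro i
    have : 0 ≤ ∑ j ∈ Finset.range m, D (i + j) * (2 * h) ^ (m - 1 - j) :=
      Finset.sum_nonneg fun j _ => mul_nonneg (D0 _) (by positivity)
    linarith
  · intro i
    have h1 : ∑ j ∈ Finset.range m, D (i + j) * (2 * h) ^ (m - 1 - j)
        ≤ ∑ j ∈ Finset.range m, (2 * h - 1) * (2 * h) ^ (m - 1 - j) :=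
      Finset.sum_le_sum fun j _ => mul_le_mul_of_nonneg_right (D1 _) (by positivity)
    rw [← Finset.mul_sum, Finset.sum_range_reflect (fun j => (2 * h) ^ j), mul_geom_sum] at h1
    linarith
  · intro i
    obtain ⟨k, rfl⟩ : ∃ k, m = k + 1 := ⟨m - 1, by omega⟩
    have e1 : ∑ j ∈ Finset.range (k + 1), D (i + j) * (2 * h) ^ (k + 1 - 1 - j)
        = (∑ j ∈ Finset.range k, D (i + 1 + j) * (2 * h) ^ (k - 1 - j)) + D i * (2 * h) ^ k := by
      rw [Finset.sum_range_succ']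
      simp only [Nat.add_sub_cancel, add_zero, Nat.sub_zero]
      congr 1
      refine Finset.sum_congr rfl fun j _ => ?_
      rw [show i + (j + 1) = i + 1 + j by omega, show k - (j + 1) = k - 1 - j by omega]
    have e2 : ∑ j ∈ Finset.range (k + 1), D (i + 1 + j) * (2 * h) ^ (k + 1 - 1 - j)
        = 2 * h * (∑ j ∈ Finset.range k, D (i + 1 + j) * (2 * h) ^ (k - 1 - j))
          + (2 * h - 1 - D i) := by
      rw [Finset.sum_range_succ, ← Dm, Finset.mul_sum]
      congr 1
      · refine Finset.sum_congr rfl fun j hj => ?_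
        rw [Finset.mem_range] at hj
        rw [show k + 1 - 1 - j = (k - 1 - j) + 1 by omega, pow_succ]
        ring
      · simp [show i + 1 + k = i + (k + 1) by omega]
    rw [e1, e2]
    change _ = 2 * h * _ - D i * _
    rw [pow_succ]
    ring

/-- An orbit that stays at or above the start of a coded orbit whose first digit is `h - 1`, and
whose negative does too, is itself coded. -/
theorem of_bounds (hh : 0 < h) (hn : ¬ 2 ∣ n) {w : ℕ → ℤ} {wb : ℕ → Bool} (Hw : OrbitCode h n w wb)
    (hr : ∀ i, n ∣ 2 * h * r i - r (i + 1)) (lo : ∀ i, w 0 ≤ r i)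
    (hi : ∀ i, r i ≤ n - w 0) : OrbitCode h n r (fun i => decide (n < 2 * r i)) := by
  have hpos : ∀ i, 0 < r i := fun i => (Hw.pos 0).trans_le (lo i)
  have hlt : ∀ i, r i < n := fun i => by linarith [Hw.pos 0, hi i]
  have hw : (h - 1) * n < 2 * h * w 0 := by
    have e := Hw.step 0
    have l := Hw.pos (0 + 1)
    have n0 : 0 < n := (hpos 0).trans (hlt 0)
    cases hb : wb 0 <;> simp [hb] at e l <;> nlinarith
  refine ⟨hpos, hlt, fun i => ?_⟩
  obtain ⟨d, hd⟩ := hr i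
  have p1 := hpos (i + 1)
  have p2 := hlt (i + 1)
  have n0 : 0 < n := (hpos 0).trans (hlt 0)
  have l1 : (h - 1) * n < 2 * h * r i := by nlinarith [lo i]
  have l2 : 2 * h * r i < (h + 1) * n := by nlinarith [hi i]
  have hd' : d = h - 1 + if n < 2 * r i then 1 else 0 := by
    by_cases hc : n < 2 * r i
    · rw [if_pos hc]
      have c1 : h * n < 2 * h * r i := by nlinarith
      have : h - 1 < d := lt_of_mul_lt_mul_right (by nlinarith : (h - 1) * n < d * n) n0.le
      have : d < h + 1 := lt_of_mul_lt_mul_right (by nlinarith : d * n < (h + 1) * n) n0.le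
      omega
    · rw [if_neg hc]
      have hne : 2 * r i ≠ n := fun e => hn ⟨_, e.symm⟩
      have c0 : 2 * r i < n := lt_of_le_of_ne (not_lt.1 hc) hne
      have c1 : 2 * h * r i < h * n := by nlinarith
      have : h - 2 < d := lt_of_mul_lt_mul_right (by nlinarith : (h - 2) * n < d * n) n0.le
      have : d < h := lt_of_mul_lt_mul_right (by nlinarith : d * n < h * n) n0.le
      omega
  simp only [decide_eq_true_eq]
  rw [← hd']
  linarith

end OrbitCode

/-! ### Lexicographic constraints on antiperiodic words -/

/-- No shift of `b`, nor of its complement, is lexicographically smaller than `w`. -/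
def Above (w b : ℕ → Bool) : Prop :=
  ∀ (i j : ℕ) (x : Bool), (∀ k < j, b (i + k) = xor (w k) x) → w j = true → b (i + j) = !x

/-- A violation at shift i would, by `lt_of_first_diff`, place r i (when x is false) or n - r i
(when x is true) strictly below w 0. -/
theorem OrbitCode.above {h n : ℤ} (hh : 0 < h) {r w : ℕ → ℤ} {b wb : ℕ → Bool}
    (H : OrbitCode h n r b) (Hw : OrbitCode h n w wb) (lo : ∀ i, w 0 ≤ r i)
    (hi : ∀ i, r i ≤ n - w 0) : Above wb b := by
  intro i j x hk hj
  by_contra hx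
  have hx : b (i + j) = x := by simpa using hx
  cases x
  · have := lt_of_first_diff hh j (H.shift i) Hw (fun k hkj => by simpa using hk k hkj) hx hj
    simp only [add_zero] at this
    linarith [lo i]
  · have := lt_of_first_diff hh j (H.shift i).compl Hw (fun k hkj => by simp [hk k hkj])
      (by simp [hx]) hj
    simp only [add_zero] at this
    linarith [hi i]

section Periodic

variable {b : ℕ → Bool} {m : ℕ}

theorem antiperiodic_add_two_mul (hb : ∀ i, b (i + m) = !b i) (i c : ℕ) :
    b (i + 2 * m * c) = b i := by
  induction c with
  | zero => simp
  | succ c ih =>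
    rw [show i + 2 * m * (c + 1) = i + 2 * m * c + m + m by ring, hb, hb, Bool.not_not, ih]

theorem exists_adjacent_eq (hm : Even m) (hb : ∀ i, b (i + m) = !b i) :
    ∃ i, b (i + 1) = b i := by
  by_contra! hne
  have h2 : ∀ i, b (i + 2) = b i := fun i => by
    have h1 := hne i
    have h2 := hne (i + 1)
    revert h1 h2
    rw [show i + 1 + 1 = i + 2 by rfl]
    cases b i <;> cases b (i + 1) <;> cases b (i + 2) <;> simp
  have h3 : ∀ c, b (2 * c) = b 0 := fun c => by
    induction c with
    | zero => rfl
    | succ c ih => rw [mul_add, mul_one, h2, ih]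
  obtain ⟨c, rfl⟩ := hm
  have := hb 0
  rw [zero_add, ← two_mul, h3] at this
  simp at this

/-- If all pairs from some point on are constant and alternate, `b` has antiperiod two. -/
theorem antiperiod_two_of_pairs (hm : 0 < m) (hb : ∀ i, b (i + m) = !b i) (i₀ : ℕ)
    (heq : ∀ k, b (i₀ + 2 * k + 1) = b (i₀ + 2 * k))
    (hflip : ∀ k, b (i₀ + 2 * (k + 1)) = !b (i₀ + 2 * k)) (i : ℕ) : b (i + 2) = !b i := by
  have key : ∀ j, b (i₀ + j + 2) = !b (i₀ + j) := fun j => by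
    rcases Nat.even_or_odd' j with ⟨k, rfl | rfl⟩
    · exact hflip k
    · have := heq (k + 1)
      rw [show i₀ + (2 * k + 1) + 2 = i₀ + 2 * (k + 1) + 1 by ring, this, hflip, ← heq]
      rfl
  -- Adding a multiple of the period 2m carries any index past i₀.
  have hi : i₀ ≤ i + 2 * m * i₀ := by nlinarith
  obtain ⟨j, hj⟩ := Nat.exists_eq_add_of_le hi
  have := key j
  rwa [← hj, antiperiodic_add_two_mul hb,
    show i + 2 * m * i₀ + 2 = (i + 2) + 2 * m * i₀ by ring, antiperiodic_add_two_mul hb] at this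

/-- As w starts with 0011, two equal bits xx must be followed by the two bits !x !x. Evenness of m
rules out a strictly alternating word, so some equal pair exists and this propagates from it. -/
theorem antiperiod_two_of_above {w : ℕ → Bool} (h0 : w 0 = false) (h1 : w 1 = false)
    (h2 : w 2 = true) (h3 : w 3 = true) (hw : Above w b) (hm0 : 0 < m) (hm : Even m)
    (hb : ∀ i, b (i + m) = !b i) (i : ℕ) : b (i + 2) = !b i := by
  obtain ⟨i₀, hi₀⟩ := exists_adjacent_eq hm hb
  have flip : ∀ i, b (i + 1) = b i → b (i + 2) = !b i ∧ b (i + 3) = !b i := fun i hi => by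
    have e2 : b (i + 2) = !b i := hw i 2 (b i) (fun k hk => by
      interval_cases k <;> simp [h0, h1, hi]) h2
    exact ⟨e2, hw i 3 (b i) (fun k hk => by
      interval_cases k <;> simp [h0, h1, h2, hi, e2]) h3⟩
  have heq : ∀ k, b (i₀ + 2 * k + 1) = b (i₀ + 2 * k) := fun k => by
    induction k with
    | zero => exact hi₀
    | succ k ih =>
      have := flip _ ih
      rw [show i₀ + 2 * (k + 1) + 1 = i₀ + 2 * k + 3 by ring,
        show i₀ + 2 * (k + 1) = i₀ + 2 * k + 2 by ring, this.1, this.2]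
  exact antiperiod_two_of_pairs hm0 hb i₀ heq (fun k => (flip _ (heq k)).1) i

end Periodic

/-- A sequence on `ℕ` with periods `l` and `N` has period `gcd l N`. -/
theorem periodic_gcd {α : Type*} {z : ℕ → α} {l N : ℕ} (hN : 0 < N) (hl : ∀ k, z (k + l) = z k)
    (hzN : ∀ k, z (k + N) = z k) (k : ℕ) : z (k + l.gcd N) = z k := by
  have hlc : ∀ c k, z (k + l * c) = z k := fun c k => by
    induction c with
    | zero => simp
    | succ c ih => rw [mul_add, mul_one, ← add_assoc, hl, ih]
  have hNc : ∀ c k, z (k + N * c) = z k := fun c k => by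
    induction c with
    | zero => simp
    | succ c ih => rw [mul_add, mul_one, ← add_assoc, hzN, ih]
  rcases (Nat.le_of_dvd hN (Nat.gcd_dvd_right l N)).eq_or_lt with he | hlt
  · rw [he, hzN]
  obtain ⟨u, -, hu⟩ := Nat.exists_mul_mod_eq_gcd hlt
  have huv := Nat.mod_add_div (l * u) N
  rw [hu] at huv
  rw [← hNc (l * u / N) (k + l.gcd N), add_assoc, huv, hlc]

/-! ### The comparison word for the second largest leader -/

/-- The alternating word `1100` repeated, complemented at the positions `-1, 0, 1, 2` modulo `m`. -/
def topWord (m : ℕ) (i : ℕ) : Bool :=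
  xor (decide (i % 4 < 2)) (decide ((i + 1) % m < 4))

theorem topWord_of_lt {m i : ℕ} (h3 : 3 ≤ i) (hi : i + 2 ≤ m) :
    topWord m i = decide (i % 4 < 2) := by
  have : ¬ (i + 1) % m < 4 := by rw [Nat.mod_eq_of_lt (by omega)]; omega
  simp [topWord, this]

theorem topWord_add {t : ℕ} (i : ℕ) :
    topWord (4 * t + 2) (i + (4 * t + 2)) = !topWord (4 * t + 2) i := by
  have e : (i + (4 * t + 2) + 1) % (4 * t + 2) = (i + 1) % (4 * t + 2) := by
    rw [show i + (4 * t + 2) + 1 = i + 1 + (4 * t + 2) by ring, Nat.add_mod_right]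
  have e2 : decide ((i + (4 * t + 2)) % 4 < 2) = !decide (i % 4 < 2) := by
    rw [← decide_not]; congr 1; apply propext; omega
  rw [topWord, topWord, e, e2, Bool.not_xor]

theorem topWord_zero {m : ℕ} (hm : 6 ≤ m) : topWord m 0 = false := by
  simp [topWord, Nat.mod_eq_of_lt (show 1 < m by omega)]

theorem topWord_one {m : ℕ} (hm : 6 ≤ m) : topWord m 1 = false := by
  simp [topWord, Nat.mod_eq_of_lt (show 2 < m by omega)]

theorem topWord_two {m : ℕ} (hm : 6 ≤ m) : topWord m 2 = true := by
  simp [topWord, Nat.mod_eq_of_lt (show 3 < m by omega)]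

theorem topWord_last (t : ℕ) : topWord (4 * t + 2) (4 * t + 1) = false := by
  simp [topWord]

/-! ### Words above `topWord`, read in pairs of bits -/

section PairAnalysis

variable {b : ℕ → Bool} {t i₀ : ℕ}

/-- The bits at positions `i₀ + 2k` and `i₀ + 2k + 1` differ. -/
def unequalPair (b : ℕ → Bool) (i₀ k : ℕ) : Bool :=
  xor (b (i₀ + 2 * k)) (b (i₀ + 2 * k + 1))

theorem unequalPair_eq_false {k : ℕ} :
    unequalPair b i₀ k = false ↔ b (i₀ + 2 * k + 1) = b (i₀ + 2 * k) := by
  unfold unequalPair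
  cases b (i₀ + 2 * k) <;> cases b (i₀ + 2 * k + 1) <;> simp

theorem unequalPair_eq_true {k : ℕ} :
    unequalPair b i₀ k = true ↔ b (i₀ + 2 * k + 1) = !b (i₀ + 2 * k) := by
  unfold unequalPair
  cases b (i₀ + 2 * k) <;> cases b (i₀ + 2 * k + 1) <;> simp

theorem Above.flip (ht : 1 ≤ t) (hw : Above (topWord (4 * t + 2)) b) {i : ℕ}
    (hi : b (i + 1) = b i) : b (i + 2) = !b i :=
  hw i 2 (b i) (fun k hk => by
    interval_cases k <;> simp [topWord_zero (show 6 ≤ 4 * t + 2 by omega),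
      topWord_one (show 6 ≤ 4 * t + 2 by omega), hi]) (topWord_two (by omega))

theorem Above.flip_pair (ht : 1 ≤ t) (hw : Above (topWord (4 * t + 2)) b) {k : ℕ}
    (hk : unequalPair b i₀ k = false) : b (i₀ + 2 * (k + 1)) = !b (i₀ + 2 * k) :=
  hw.flip ht (unequalPair_eq_false.1 hk)

/-- The bits following an equal pair, an unequal pair and `e` equal pairs agree with `topWord`. -/
theorem Above.agree (ht : 2 ≤ t) (hw : Above (topWord (4 * t + 2)) b) {k : ℕ}
    (hk : unequalPair b i₀ k = false) (hk1 : unequalPair b i₀ (k + 1) = true) (e : ℕ) :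
    (∀ j < e, unequalPair b i₀ (k + 2 + j) = false) → e + 2 ≤ 2 * t →
    (∀ j < 2 * (e + 2),
      b (i₀ + 2 * k + j) = xor (topWord (4 * t + 2) j) (b (i₀ + 2 * k))) ∧
    b (i₀ + 2 * k + 2 * (e + 2)) =
      xor (topWord (4 * t + 2) (2 * (e + 2))) (b (i₀ + 2 * k)) := by
  have w0 := topWord_zero (show 6 ≤ 4 * t + 2 by omega)
  have w1 := topWord_one (show 6 ≤ 4 * t + 2 by omega)
  have w2 := topWord_two (show 6 ≤ 4 * t + 2 by omega)
  induction e with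
  | zero =>
    intro _ _
    have w3 : topWord (4 * t + 2) 3 = false := by rw [topWord_of_lt] <;> simp; omega
    have w4 : topWord (4 * t + 2) 4 = true := by rw [topWord_of_lt] <;> simp; omega
    have e1 := unequalPair_eq_false.1 hk
    have e2 := hw.flip_pair (by omega) hk
    have e3 := unequalPair_eq_true.1 hk1
    rw [e2] at e3
    rw [show i₀ + 2 * (k + 1) = i₀ + 2 * k + 2 by ring] at e2
    rw [show i₀ + 2 * (k + 1) + 1 = i₀ + 2 * k + 3 by ring] at e3
    have hA : ∀ j < 2 * (0 + 2),
        b (i₀ + 2 * k + j) = xor (topWord (4 * t + 2) j) (b (i₀ + 2 * k)) := by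
      intro j hj
      interval_cases j
      · simp [w0]
      · simp [w1, e1]
      · simp [w2, e2]
      · simp [w3, e3]
    refine ⟨hA, ?_⟩
    rw [hw (i₀ + 2 * k) 4 (b (i₀ + 2 * k)) hA w4, w4]
    simp
  | succ e ih =>
    intro hz he
    obtain ⟨hA, hB⟩ := ih (fun j hj => hz j (by omega)) (by omega)
    have q := hz e (by omega)
    have q1 := unequalPair_eq_false.1 q
    have q2 := hw.flip_pair (by omega) q
    rw [show i₀ + 2 * (k + 2 + e) + 1 = i₀ + 2 * k + (2 * (e + 2) + 1) by ring,
      show i₀ + 2 * (k + 2 + e) = i₀ + 2 * k + 2 * (e + 2) by ring, hB] at q1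
    rw [show i₀ + 2 * (k + 2 + e + 1) = i₀ + 2 * k + 2 * (e + 1 + 2) by ring,
      show i₀ + 2 * (k + 2 + e) = i₀ + 2 * k + 2 * (e + 2) by ring, hB] at q2
    have v0 : topWord (4 * t + 2) (2 * (e + 2) + 1) = topWord (4 * t + 2) (2 * (e + 2)) := by
      rw [topWord_of_lt (by omega) (by omega), topWord_of_lt (by omega) (by omega)]
      congr 1; apply propext; omega
    have v1 : topWord (4 * t + 2) (2 * (e + 1 + 2)) = !topWord (4 * t + 2) (2 * (e + 2)) := by
      rw [topWord_of_lt (by omega) (by omega), topWord_of_lt (by omega) (by omega),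
        ← decide_not]
      congr 1; apply propext; omega
    refine ⟨fun j hj => ?_, ?_⟩
    · rcases Nat.lt_or_ge j (2 * (e + 2)) with h | h
      · exact hA j h
      · rcases (show j = 2 * (e + 2) ∨ j = 2 * (e + 2) + 1 by omega) with rfl | rfl
        · exact hB
        · rw [q1, v0]
    · rw [q2, v1, Bool.not_xor]

/-- Up to this point the bits agree with `topWord`, possibly complemented. For even e the next two
bits of `topWord` are 11, and a word above it must follow at each 1. Hence the number of equal pairs
separating two unequal ones is odd, as long as the gap is short. -/
theorem Above.unequalPair_add_two (ht : 2 ≤ t) (hw : Above (topWord (4 * t + 2)) b) {k e : ℕ}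
    (hk : unequalPair b i₀ k = false) (hk1 : unequalPair b i₀ (k + 1) = true)
    (hz : ∀ j < e, unequalPair b i₀ (k + 2 + j) = false) (he : e + 2 ≤ 2 * t - 1)
    (hev : Even e) : unequalPair b i₀ (k + 2 + e) = false := by
  obtain ⟨hA, hB⟩ := hw.agree ht hk hk1 e hz (by omega)
  obtain ⟨c, rfl⟩ := hev
  have v0 : topWord (4 * t + 2) (2 * (c + c + 2)) = true := by
    rw [topWord_of_lt (by omega) (by omega)]; simp; omega
  have v1 : topWord (4 * t + 2) (2 * (c + c + 2) + 1) = true := by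
    rw [topWord_of_lt (by omega) (by omega)]; simp; omega
  have := hw (i₀ + 2 * k) (2 * (c + c + 2) + 1) (b (i₀ + 2 * k)) (fun j hj => by
    rcases Nat.lt_or_ge j (2 * (c + c + 2)) with h | h
    · exact hA j h
    · obtain rfl : j = 2 * (c + c + 2) := by omega
      exact hB) v1
  rw [unequalPair_eq_false,
    show i₀ + 2 * (k + 2 + (c + c)) + 1 = i₀ + 2 * k + (2 * (c + c + 2) + 1) by ring, this,
    show i₀ + 2 * (k + 2 + (c + c)) = i₀ + 2 * k + 2 * (c + c + 2) by ring, hB, v0]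
  simp

/-- A sequence lying above `topWord` is either antiperiodic of order two or has full period. -/
theorem Above.period_eq (ht : 1 ≤ t) (hw : Above (topWord (4 * t + 2)) b)
    (hb : ∀ i, b (i + (4 * t + 2)) = !b i) (h2 : ¬ ∀ i, b (i + 2) = !b i) {l : ℕ}
    (hl : ∀ i, b (i + l) = b i) (hdvd : l ∣ 2 * (4 * t + 2)) : l = 2 * (4 * t + 2) := by
  obtain ⟨i₀, hi₀⟩ := exists_adjacent_eq (⟨2 * t + 1, by ring⟩) hb
  set z := unequalPair b i₀ with hz
  have z0 : z 0 = false := unequalPair_eq_false.2 hi₀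
  have zN : ∀ k, z (k + (2 * t + 1)) = z k := fun k => by
    simp only [hz, unequalPair]
    rw [show i₀ + 2 * (k + (2 * t + 1)) = i₀ + 2 * k + (4 * t + 2) by ring, hb,
      show i₀ + 2 * k + (4 * t + 2) + 1 = i₀ + 2 * k + 1 + (4 * t + 2) by ring, hb]
    simp
  have zl : ∀ k, z (k + l) = z k := fun k => by
    simp only [hz, unequalPair]
    rw [show i₀ + 2 * (k + l) = i₀ + 2 * k + l + l by ring, hl, hl,
      show i₀ + 2 * k + l + l + 1 = i₀ + 2 * k + 1 + l + l by ring, hl, hl]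
  set P := l.gcd (2 * t + 1) with hP
  have zP : ∀ k, z (k + P) = z k := periodic_gcd (by omega) zl zN
  have hex : ∃ k, z k = true := by
    by_contra! hne
    have hne : ∀ k, z k = false := fun k => by simpa using hne k
    exact h2 (antiperiod_two_of_pairs (by omega) hb i₀ (fun k => unequalPair_eq_false.1 (hne k))
      fun k => hw.flip_pair ht (hne k))
  obtain ⟨c, hc⟩ : P ∣ 2 * t + 1 := Nat.gcd_dvd_right _ _
  have hPodd : Odd P := (Nat.odd_mul.1 (hc ▸ (⟨t, rfl⟩ : Odd (2 * t + 1)))).1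
  have hcodd : Odd c := (Nat.odd_mul.1 (hc ▸ (⟨t, rfl⟩ : Odd (2 * t + 1)))).2
  have hc1 : c = 1 := by
    by_contra hc1
    have hc3 : 3 ≤ c := by
      obtain ⟨d, rfl⟩ := hcodd
      omega
    have hP1 : P ≠ 1 := by
      intro h1
      rw [h1] at zP
      have : ∀ k, z k = false := fun k => by
        induction k with
        | zero => exact z0
        | succ k ih => rw [zP, ih]
      obtain ⟨k, hk⟩ := hex
      simp [this k] at hk
    have hP3 : 3 ≤ P := by
      obtain ⟨d, hd⟩ := hPodd
      omega
    have hPt : 3 * P ≤ 2 * t + 1 := by nlinarith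
    classical
    have hκ := Nat.find_spec hex
    have hmin : ∀ k < Nat.find hex, z k = false := fun k hk => by
      simpa using Nat.find_min hex hk
    set κ := Nat.find hex with hκdef
    obtain ⟨κ', hκ'⟩ : ∃ κ', κ = κ' + 1 := by
      rcases Nat.eq_zero_or_pos κ with h | h
      · rw [h, z0] at hκ; simp at hκ
      · exact ⟨κ - 1, by omega⟩
    -- Gaps of odd length put the unequal pairs at even distances from κ. By periodicity κ + P is an
    -- unequal pair too, which contradicts the oddness of P. The bound 3P ≤ 2t + 1 keeps every gap
    -- short enough.
    have claim : ∀ d ≤ P, z (κ + d) = true → Even d ∧ z (κ' + d) = false := by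
      intro d
      induction d using Nat.strong_induction_on with
      | _ d ih =>
      intro hd hzd
      rcases Nat.eq_zero_or_pos d with rfl | hd0
      · exact ⟨Even.zero, hmin _ (by omega)⟩
      have hS : ((Finset.range d).filter fun a => z (κ + a) = true).Nonempty :=
        ⟨0, by simp [hd0, hκ]⟩
      obtain ⟨a, ha, hmax⟩ := Finset.exists_max_image _ id hS
      simp only [Finset.mem_filter, Finset.mem_range, id] at ha hmax
      obtain ⟨haev, hapre⟩ := ih a ha.1 (by omega) ha.2
      obtain ⟨g, rfl⟩ : ∃ g, d = a + 1 + g := ⟨d - a - 1, by omega⟩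
      have hgap : ∀ j < g, z (κ' + a + 2 + j) = false := fun j hj => by
        by_contra hne
        have := hmax (a + 1 + j) ⟨by omega, by
          rw [hκ', show κ' + 1 + (a + 1 + j) = κ' + a + 2 + j by ring]; simpa using hne⟩
        omega
      have hgodd : ¬ Even g := fun hg => by
        have := hw.unequalPair_add_two (i₀ := i₀) (by omega) hapre
          (by rw [← hz, ← ha.2, hκ']; congr 1; ring) hgap (by omega) hg
        rw [← hz, show κ' + a + 2 + g = κ + (a + 1 + g) by rw [hκ']; ring, hzd] at this
        simp at this
      rw [Nat.not_even_iff_odd] at hgodd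
      refine ⟨?_, ?_⟩
      · rw [add_assoc]
        exact haev.add (by rw [add_comm]; exact hgodd.add_one)
      · obtain ⟨g', rfl⟩ := hgodd
        have := hgap (2 * g') (by omega)
        rwa [show κ' + (a + 1 + (2 * g' + 1)) = κ' + a + 2 + 2 * g' by ring]
    have hev := (claim P le_rfl (by rw [zP, hκ])).1
    exact (Nat.not_even_iff_odd.2 hPodd) hev
  rw [hc1, mul_one] at hc
  -- Now l = (2t + 1)u with u dividing 4. For u = 1 or u = 2 the antiperiod 4t + 2 would be a
  -- multiple of the period l.
  obtain ⟨u, hu⟩ : 2 * t + 1 ∣ l := hc ▸ Nat.gcd_dvd_left _ _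
  obtain ⟨v, hv⟩ := hdvd
  have huv : u * v = 4 := by
    have : (2 * t + 1) * (u * v) = (2 * t + 1) * 4 := by
      rw [← mul_assoc, ← hu, ← hv]; ring
    exact Nat.eq_of_mul_eq_mul_left (by omega) this
  have hu4 : u ≤ 4 := Nat.le_of_dvd (by omega) ⟨v, huv.symm⟩
  have hn2 : b (0 + (4 * t + 2)) ≠ b 0 := by rw [hb]; simp
  interval_cases u
  · omega
  · exact absurd (by rw [show 0 + (4 * t + 2) = 0 + l + l by omega, hl, hl]) hn2
  · exact absurd (by rw [show 0 + (4 * t + 2) = 0 + l by omega, hl]) hn2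
  · omega
  · omega

end PairAnalysis

/-! ### `topWord` precedes its shifts and their complements -/

theorem topWord_true {t i : ℕ} (h3 : 3 ≤ i) (hi : i ≤ 4 * t) (h : i % 4 < 2) :
    topWord (4 * t + 2) i = true := by
  rw [topWord_of_lt h3 (by omega), decide_eq_true h]

theorem topWord_false {t i : ℕ} (h3 : 3 ≤ i) (hi : i ≤ 4 * t) (h : 2 ≤ i % 4) :
    topWord (4 * t + 2) i = false := by
  rw [topWord_of_lt h3 (by omega)]; simpa

/-- `topWord` is lexicographically below its other shifts within one antiperiod. -/
theorem topWord_shift_first_diff {t i : ℕ} (ht : 1 ≤ t) (h0 : 0 < i) (hi : i < 4 * t + 2) :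
    ∃ j, (∀ k < j, topWord (4 * t + 2) k = topWord (4 * t + 2) (i + k)) ∧
      topWord (4 * t + 2) j = false ∧ topWord (4 * t + 2) (i + j) = true := by
  have w0 := topWord_zero (show 6 ≤ 4 * t + 2 by omega)
  have w1 := topWord_one (show 6 ≤ 4 * t + 2 by omega)
  have w2 := topWord_two (show 6 ≤ 4 * t + 2 by omega)
  have w3 : topWord (4 * t + 2) 3 = false := topWord_false le_rfl (by omega) (by norm_num)
  have wl := topWord_last t
  have wm : ∀ i, topWord (4 * t + 2) (4 * t + 2 + i) = !topWord (4 * t + 2) i := fun i => by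
    rw [add_comm (4 * t + 2) i, topWord_add]
  by_cases i1 : i = 1
  · subst i1
    exact ⟨1, fun k hk => by interval_cases k; simp [w0, w1], w1, w2⟩
  by_cases i2 : i = 2
  · subst i2
    exact ⟨0, fun k hk => by omega, w0, w2⟩
  by_cases il : i = 4 * t + 1
  · subst il
    refine ⟨1, fun k hk => ?_, w1, ?_⟩
    · interval_cases k; simp [w0, wl]
    · have := wm 0
      rwa [w0] at this
  by_cases c1 : i % 4 < 2
  · exact ⟨0, fun k hk => by omega, w0, topWord_true (by omega) (by omega) c1⟩
  have v0 : topWord (4 * t + 2) i = false := topWord_false (by omega) (by omega) (by omega)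
  by_cases c2 : i % 4 = 3
  · exact ⟨1, fun k hk => by interval_cases k; simp [w0, v0], w1,
      topWord_true (by omega) (by omega) (by omega)⟩
  have v1 : topWord (4 * t + 2) (i + 1) = false :=
    topWord_false (by omega) (by omega) (by omega)
  have v2 : topWord (4 * t + 2) (i + 2) = true :=
    topWord_true (by omega) (by omega) (by omega)
  by_cases c3 : i + 3 ≤ 4 * t
  · refine ⟨3, fun k hk => ?_, w3, topWord_true (by omega) (by omega) (by omega)⟩
    interval_cases k <;> simp [w0, v0, w1, v1, w2, v2]
  -- Only the shift i = m - 4 is left. It reads 0010, then the complemented start 1101, against 0010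
  -- 1100; the first difference is at position 7.
  obtain ⟨u, rfl⟩ : ∃ u, t = u + 2 := ⟨t - 2, by omega⟩
  obtain rfl : i = 4 * u + 6 := by omega
  have w4 : topWord (4 * (u + 2) + 2) 4 = true := topWord_true (by omega) (by omega) (by norm_num)
  have w5 : topWord (4 * (u + 2) + 2) 5 = true := topWord_true (by omega) (by omega) (by norm_num)
  have w6 : topWord (4 * (u + 2) + 2) 6 = false :=
    topWord_false (by omega) (by omega) (by norm_num)
  have w7 : topWord (4 * (u + 2) + 2) 7 = false :=
    topWord_false (by omega) (by omega) (by norm_num)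
  have v3 : topWord (4 * (u + 2) + 2) (4 * u + 6 + 3) = false := wl
  have v4 : topWord (4 * (u + 2) + 2) (4 * u + 6 + 4) = true := by
    rw [show 4 * u + 6 + 4 = 4 * (u + 2) + 2 + 0 by ring, wm, w0]; rfl
  have v5 : topWord (4 * (u + 2) + 2) (4 * u + 6 + 5) = true := by
    rw [show 4 * u + 6 + 5 = 4 * (u + 2) + 2 + 1 by ring, wm, w1]; rfl
  have v6 : topWord (4 * (u + 2) + 2) (4 * u + 6 + 6) = false := by
    rw [show 4 * u + 6 + 6 = 4 * (u + 2) + 2 + 2 by ring, wm, w2]; rfl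
  have v7 : topWord (4 * (u + 2) + 2) (4 * u + 6 + 7) = true := by
    rw [show 4 * u + 6 + 7 = 4 * (u + 2) + 2 + 3 by ring, wm, w3]; rfl
  refine ⟨7, fun k hk => ?_, w7, v7⟩
  interval_cases k
  · rw [w0, ← v0]
  · rw [w1, v1]
  · rw [w2, v2]
  · rw [w3, v3]
  · rw [w4, v4]
  · rw [w5, v5]
  · rw [w6, v6]

/-- `topWord` is lexicographically below the complements of its shifts. -/
theorem topWord_compl_first_diff {t i : ℕ} (ht : 1 ≤ t) (hi : i < 4 * t + 2) :
    ∃ j, (∀ k < j, topWord (4 * t + 2) k = !topWord (4 * t + 2) (i + k)) ∧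
      topWord (4 * t + 2) j = false ∧ (!topWord (4 * t + 2) (i + j)) = true := by
  have w0 := topWord_zero (show 6 ≤ 4 * t + 2 by omega)
  have w1 := topWord_one (show 6 ≤ 4 * t + 2 by omega)
  have w2 := topWord_two (show 6 ≤ 4 * t + 2 by omega)
  have w3 : topWord (4 * t + 2) 3 = false := topWord_false le_rfl (by omega) (by norm_num)
  have wl := topWord_last t
  by_cases hf : topWord (4 * t + 2) i = false
  · exact ⟨0, fun k hk => by omega, w0, by simp [hf]⟩
  have v0 : topWord (4 * t + 2) i = true := by simpa using hf
  by_cases hf1 : topWord (4 * t + 2) (i + 1) = false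
  · exact ⟨1, fun k hk => by interval_cases k; simp [w0, v0], w1, by simp [hf1]⟩
  have v1 : topWord (4 * t + 2) (i + 1) = true := by simpa using hf1
  have i0 : i ≠ 0 := by rintro rfl; exact hf w0
  have i1 : i ≠ 1 := by rintro rfl; exact hf w1
  have i2 : i ≠ 2 := by rintro rfl; exact hf1 w3
  have il : i ≠ 4 * t + 1 := by rintro rfl; exact hf wl
  have il' : i ≠ 4 * t := by rintro rfl; exact hf1 wl
  have c1 : i % 4 < 2 := by
    by_contra h
    exact hf (topWord_false (by omega) (by omega) (by omega))
  have c2 : (i + 1) % 4 < 2 := by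
    by_contra h
    exact hf1 (topWord_false (by omega) (by omega) (by omega))
  have v2 : topWord (4 * t + 2) (i + 2) = false :=
    topWord_false (by omega) (by omega) (by omega)
  have v3 : topWord (4 * t + 2) (i + 3) = false :=
    topWord_false (by omega) (by omega) (by omega)
  exact ⟨3, fun k hk => by interval_cases k <;> simp [w0, v0, w1, v1, w2, v2], w3, by simp [v3]⟩

/-! ### From word comparisons back to bounds on orbits -/

namespace OrbitCode

variable {h n : ℤ} {r : ℕ → ℤ}

theorem antiperiodic (hh : 0 < h) {b : ℕ → Bool} (H : OrbitCode h n r b) {m : ℕ}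
    (hb : ∀ i, b (i + m) = !b i) (i : ℕ) : r (i + m) = n - r i := by
  have := congr_seq hh (H.shift m) H.compl (fun i => by rw [add_comm, hb]) i
  rwa [add_comm] at this

/-- Bounds within one antiperiod extend to the whole orbit. -/
theorem bounds_of_antiperiodic {m : ℕ} (hm : 0 < m) (hr : ∀ i, r (i + m) = n - r i) {a : ℤ}
    (H : ∀ i < m, a ≤ r i ∧ r i ≤ n - a) (i : ℕ) : a ≤ r i ∧ r i ≤ n - a := by
  induction i using Nat.strong_induction_on with
  | _ i ih =>
  rcases Nat.lt_or_ge i m with h | h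
  · exact H i h
  · obtain ⟨j, rfl⟩ := Nat.exists_eq_add_of_le' h
    have := ih j (by omega)
    rw [hr]
    constructor <;> linarith

theorem topWord_bounds (hh : 0 < h) {t : ℕ} (ht : 1 ≤ t)
    (H : OrbitCode h n r (topWord (4 * t + 2))) (i : ℕ) : r 0 ≤ r i ∧ r i ≤ n - r 0 := by
  refine bounds_of_antiperiodic (by omega) (H.antiperiodic hh topWord_add) (fun i hi => ?_) i
  constructor
  · rcases Nat.eq_zero_or_pos i with rfl | h0
    · exact le_rfl
    obtain ⟨j, h1, h2, h3⟩ := topWord_shift_first_diff ht h0 hi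
    exact (lt_of_first_diff hh j H (H.shift i) h1 h2 h3).le
  · obtain ⟨j, h1, h2, h3⟩ := topWord_compl_first_diff ht hi
    have := lt_of_first_diff hh j H (H.shift i).compl h1 h2 h3
    simp only [add_zero] at this
    linarith

theorem double_bounds (hh : 0 < h) (H : OrbitCode h n r (fun i => decide (2 ≤ i % 4))) (i : ℕ) :
    r 0 ≤ r i ∧ r i ≤ n - r 0 := by
  have hanti : ∀ i, decide (2 ≤ (i + 2) % 4) = !decide (2 ≤ i % 4) := fun i => by
    rw [← decide_not]; congr 1; apply propext; omega
  refine bounds_of_antiperiodic two_pos (H.antiperiodic hh hanti) (fun i hi => ?_) i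
  interval_cases i
  · have := lt_of_first_diff hh 0 H (H.shift 2) (by simp) (by simp) (by simp)
    have e := H.antiperiodic hh hanti 0
    simp at this e
    constructor <;> linarith
  · have l1 := lt_of_first_diff hh 1 H (H.shift 1) (by simp) (by simp) (by simp)
    have l2 := lt_of_first_diff hh 0 H (H.shift 3) (by simp) (by simp) (by simp)
    have e := H.antiperiodic hh hanti 1
    simp at l1 l2 e
    constructor <;> linarith

/-- The least element of an orbit of type `0011` is determined. -/
theorem eq_of_antiperiod_two (hh : 0 < h) {b b' : ℕ → Bool} {r' : ℕ → ℤ}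
    (H : OrbitCode h n r b) (H' : OrbitCode h n r' b') (hb : ∀ i, b (i + 2) = !b i)
    (hb' : ∀ i, b' (i + 2) = !b' i) (hr : ∀ i, r 0 ≤ r i) (hr' : ∀ i, r' 0 ≤ r' i) :
    r 0 = r' 0 := by
  -- The word is a rotation of 0011. If it begins with 1, the shift by 2 is smaller; if it begins
  -- with 01, the shift by 3 is. So a least element starts with 00.
  have key : ∀ {r : ℕ → ℤ} {b : ℕ → Bool}, OrbitCode h n r b → (∀ i, b (i + 2) = !b i) →
      (∀ i, r 0 ≤ r i) → b 0 = false ∧ b 1 = false := by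
    intro r b H hb hr
    have b0 : b 0 = false := by
      by_contra h0
      have h0 : b 0 = true := by simpa using h0
      have := lt_of_first_diff hh 0 (H.shift 2) H (by simp)
        (by have := hb 0; simpa [h0] using this) h0
      simp only [add_zero] at this
      linarith [hr 2]
    refine ⟨b0, ?_⟩
    by_contra h1
    have h1 : b 1 = true := by simpa using h1
    have b3 : b 3 = false := by simpa [h1] using hb 1
    have b2 : b 2 = true := by simpa [b0] using hb 0
    have b4 : b 4 = false := by simpa [b2] using hb 2
    have := lt_of_first_diff hh 1 (H.shift 3) H (fun k hk => by
      interval_cases k; simp [b3, b0]) b4 h1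
    simp only [add_zero] at this
    linarith [hr 3]
  obtain ⟨k0, k1⟩ := key H hb hr
  obtain ⟨k0', k1'⟩ := key H' hb' hr'
  refine ext_zero hh H H' fun i => ?_
  induction i using Nat.strong_induction_on with
  | _ i ih =>
  match i with
  | 0 => rw [k0, k0']
  | 1 => rw [k1, k1']
  | i + 2 => rw [hb, hb', ih i (by omega)]

end OrbitCode

/-! ### Cyclotomic cosets and their leaders -/

section Coset

variable {q n : ℕ}

theorem mul_pow_mod_orderOf (s i : ℕ) :
    s * q ^ (i % orderOf (q : ZMod n)) % n = s * q ^ i % n := by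
  rw [← ZMod.natCast_eq_natCast_iff']
  push_cast
  rw [pow_mod_orderOf]

theorem mem_cyclotomicCoset (ho : 0 < orderOf (q : ZMod n)) {s x : ℕ} :
    x ∈ cyclotomicCoset q n s ↔ ∃ i, s * q ^ i % n = x := by
  simp only [cyclotomicCoset, Finset.mem_image, Finset.mem_range]
  constructor
  · rintro ⟨i, -, h⟩; exact ⟨i, h⟩
  · rintro ⟨i, h⟩; exact ⟨i % _, Nat.mod_lt _ ho, by rw [mul_pow_mod_orderOf, h]⟩

theorem mod_mul_pow_mod (s i j : ℕ) : s * q ^ i % n * q ^ j % n = s * q ^ (i + j) % n := by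
  rw [Nat.mod_mul_mod, pow_add, mul_assoc]

theorem cyclotomicCoset_eq_of_mem (ho : 0 < orderOf (q : ZMod n)) {s x : ℕ}
    (hx : x ∈ cyclotomicCoset q n s) : cyclotomicCoset q n x = cyclotomicCoset q n s := by
  obtain ⟨i, rfl⟩ := (mem_cyclotomicCoset ho).1 hx
  ext y
  simp only [mem_cyclotomicCoset ho, mod_mul_pow_mod]
  constructor
  · rintro ⟨j, h⟩; exact ⟨_, h⟩
  · rintro ⟨j, h⟩
    refine ⟨j + (orderOf (q : ZMod n) * i - i), ?_⟩
    have : i ≤ orderOf (q : ZMod n) * i := Nat.le_mul_of_pos_left _ ho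
    rw [← h, ← mul_pow_mod_orderOf s (i + _), ← mul_pow_mod_orderOf s j]
    congr 3
    rw [show i + (j + (orderOf (q : ZMod n) * i - i)) = j + orderOf (q : ZMod n) * i by omega,
      Nat.add_mul_mod_self_left]

theorem cosetLeader_mem (ho : 0 < orderOf (q : ZMod n)) (s : ℕ) :
    cosetLeader q n s ∈ cyclotomicCoset q n s :=
  Nat.sInf_mem (s := (cyclotomicCoset q n s : Set ℕ))
    ⟨_, Finset.mem_coe.2 ((mem_cyclotomicCoset ho).2 ⟨0, rfl⟩)⟩

theorem cosetLeader_le {s x : ℕ} (hx : x ∈ cyclotomicCoset q n s) : cosetLeader q n s ≤ x :=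
  Nat.sInf_le hx

theorem self_mem_cyclotomicCoset (ho : 0 < orderOf (q : ZMod n)) {s : ℕ} (hs : s < n) :
    s ∈ cyclotomicCoset q n s :=
  (mem_cyclotomicCoset ho).2 ⟨0, by rw [pow_zero, mul_one, Nat.mod_eq_of_lt hs]⟩

theorem cosetLeader_eq_of_mem (ho : 0 < orderOf (q : ZMod n)) {s x : ℕ}
    (hx : x ∈ cyclotomicCoset q n s) : cosetLeader q n x = cosetLeader q n s := by
  rw [cosetLeader, cosetLeader, cyclotomicCoset_eq_of_mem ho hx]

theorem lt_of_mem_cyclotomicCoset (hn : 0 < n) {s x : ℕ} (hx : x ∈ cyclotomicCoset q n s) :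
    x < n := by
  simp only [cyclotomicCoset, Finset.mem_image] at hx
  obtain ⟨i, -, rfl⟩ := hx
  exact Nat.mod_lt _ hn

theorem mem_minRep (hn : 0 < n) (ho : 0 < orderOf (q : ZMod n)) {a : ℕ} :
    a ∈ minRep q n ↔ a < n ∧ ∀ i, a ≤ a * q ^ i % n := by
  simp only [minRep, Finset.mem_image, Finset.mem_range]
  constructor
  · rintro ⟨s, -, rfl⟩
    have hm := cosetLeader_mem (n := n) ho s
    refine ⟨lt_of_mem_cyclotomicCoset hn hm, fun i => ?_⟩
    apply cosetLeader_le
    rw [← cyclotomicCoset_eq_of_mem ho hm]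
    exact (mem_cyclotomicCoset ho).2 ⟨i, rfl⟩
  · rintro ⟨ha, h⟩
    refine ⟨a, ha, le_antisymm (cosetLeader_le (self_mem_cyclotomicCoset ho ha)) ?_⟩
    obtain ⟨i, hi⟩ := (mem_cyclotomicCoset ho).1 (cosetLeader_mem (n := n) ho a)
    rw [← hi]
    exact h i

theorem cosetLeader_mem_minRep (hn : 0 < n) (ho : 0 < orderOf (q : ZMod n)) (s : ℕ) :
    cosetLeader q n s ∈ minRep q n := by
  rw [← cosetLeader_eq_of_mem ho (cosetLeader_mem ho s)]
  exact Finset.mem_image_of_mem _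
    (Finset.mem_range.2 (lt_of_mem_cyclotomicCoset hn (cosetLeader_mem ho s)))

theorem cosetLeader_eq_self (hn : 0 < n) (ho : 0 < orderOf (q : ZMod n)) {a : ℕ}
    (ha : a ∈ minRep q n) : cosetLeader q n a = a := by
  obtain ⟨h1, h2⟩ := (mem_minRep hn ho).1 ha
  refine le_antisymm (cosetLeader_le (self_mem_cyclotomicCoset ho h1)) ?_
  obtain ⟨i, hi⟩ := (mem_cyclotomicCoset ho).1 (cosetLeader_mem (n := n) ho a)
  rw [← hi]
  exact h2 i

/-- Residues in a coset are exactly those with the given leader. -/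
theorem mem_cyclotomicCoset_iff (hn : 0 < n) (ho : 0 < orderOf (q : ZMod n)) {a : ℕ}
    (ha : a ∈ minRep q n) {j : ℕ} (hj : j < n) :
    j ∈ cyclotomicCoset q n a ↔ cosetLeader q n j = a := by
  constructor
  · intro h
    rw [cosetLeader_eq_of_mem ho h, cosetLeader_eq_self hn ho ha]
  · intro h
    have := cosetLeader_mem (n := n) ho j
    rw [h] at this
    rw [cyclotomicCoset_eq_of_mem ho this]
    exact self_mem_cyclotomicCoset ho hj

theorem card_cyclotomicCoset (ho : 0 < orderOf (q : ZMod n)) (hq : q.Coprime n) {s P : ℕ}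
    (hP : 0 < P) (hs : ∀ l, s * q ^ l % n = s % n ↔ P ∣ l) :
    (cyclotomicCoset q n s).card = P := by
  have hadd : ∀ c i, s * q ^ (i + P * c) % n = s * q ^ i % n := fun c i => by
    have := (hs (P * c)).2 (dvd_mul_right _ _)
    rw [add_comm, ← mod_mul_pow_mod, this, Nat.mod_mul_mod]
  have : cyclotomicCoset q n s = (Finset.range P).image fun i => s * q ^ i % n := by
    ext x
    simp only [mem_cyclotomicCoset ho, Finset.mem_image, Finset.mem_range]
    constructor
    · rintro ⟨i, rfl⟩
      refine ⟨i % P, Nat.mod_lt _ hP, ?_⟩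
      conv_rhs => rw [← Nat.mod_add_div i P, hadd]
    · rintro ⟨i, -, h⟩; exact ⟨i, h⟩
  rw [this, Finset.card_image_of_injOn, Finset.card_range]
  have key : ∀ i j, i ≤ j → j < P → s * q ^ i % n = s * q ^ j % n → i = j := by
    intro i j hij hj he
    obtain ⟨d, rfl⟩ := Nat.exists_eq_add_of_le hij
    have h1 : s * q ^ d * q ^ i ≡ s * q ^ i [MOD n] := by
      rw [mul_assoc, ← pow_add, add_comm d]; exact he.symm
    have h2 : s * q ^ d ≡ s * 1 [MOD n] := by
      rw [mul_one]
      exact Nat.ModEq.cancel_right_of_coprime (by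
        rw [Nat.gcd_comm]; exact Nat.Coprime.pow_left i hq) h1
    rw [mul_one] at h2
    have := (hs d).1 h2
    rcases Nat.eq_zero_or_pos d with rfl | hd
    · rfl
    · have := Nat.le_of_dvd hd this; omega
  intro i hi j hj he
  simp only [Finset.coe_range, Set.mem_Iio] at hi hj
  rcases le_total i j with h | h
  · exact key i j h hj he
  · exact (key j i h hi he.symm).symm

/-- The residues modulo `n` not lying in a coset of an exponent below `δ`. -/
theorem forall_notMem_cyclotomicCoset_iff (hn : 0 < n) (ho : 0 < orderOf (q : ZMod n)) {δ j : ℕ}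
    (hj : j < n) :
    (∀ i ∈ Finset.Ico 0 δ, j ∉ cyclotomicCoset q n i) ↔ δ ≤ cosetLeader q n j := by
  constructor
  · intro h
    by_contra hlt
    exact h _ (Finset.mem_Ico.2 ⟨Nat.zero_le _, not_le.1 hlt⟩)
      ((mem_cyclotomicCoset_iff hn ho (cosetLeader_mem_minRep hn ho j) hj).2 rfl)
  · intro h i hi hmem
    have h1 := cosetLeader_le ((mem_cyclotomicCoset (n := n) ho).2 ⟨0, rfl⟩ :
      i * q ^ 0 % n ∈ cyclotomicCoset q n i)
    rw [← cosetLeader_eq_of_mem ho hmem, pow_zero, mul_one] at h1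
    have := Nat.mod_le i n
    simp at hi
    omega

theorem zero_mem_cyclotomicCoset (ho : 0 < orderOf (q : ZMod n)) (hq : q.Coprime n) {i : ℕ} :
    0 ∈ cyclotomicCoset q n i ↔ n ∣ i := by
  rw [mem_cyclotomicCoset ho]
  constructor
  · rintro ⟨j, h⟩
    exact (Nat.Coprime.pow_left j hq).symm.dvd_of_dvd_mul_right (Nat.dvd_of_mod_eq_zero h)
  · intro h
    exact ⟨0, Nat.mod_eq_zero_of_dvd (by simpa using h)⟩

/-- Leaving out the exponent 0 frees exactly the residue 0, because δ ≤ n keeps every multiple of n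
out of the range. This is the extra dimension of the codes with b = 1. -/
theorem forall_notMem_cyclotomicCoset_iff_one (hn : 0 < n) (ho : 0 < orderOf (q : ZMod n))
    (hq : q.Coprime n) {δ j : ℕ} (hδ : δ ≤ n) (hj : j < n) :
    (∀ i ∈ Finset.Ico 1 δ, j ∉ cyclotomicCoset q n i) ↔ j = 0 ∨ δ ≤ cosetLeader q n j := by
  rcases Nat.eq_zero_or_pos j with rfl | hj0
  · simp only [true_or, iff_true, zero_mem_cyclotomicCoset ho hq]
    intro i hi hd
    rw [Finset.mem_Ico] at hi
    have := Nat.le_of_dvd (by omega) hd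
    omega
  · have h0 : j ∉ cyclotomicCoset q n 0 := by
      rw [mem_cyclotomicCoset ho]
      rintro ⟨i, h⟩
      simp at h
      omega
    rw [← forall_notMem_cyclotomicCoset_iff hn ho hj]
    simp only [hj0.ne', false_or, Finset.mem_Ico]
    constructor
    · intro h i hi
      rcases Nat.eq_zero_or_pos i with rfl | hi0
      · exact h0
      · exact h i ⟨hi0, hi.2⟩
    · intro h i hi
      exact h i ⟨Nat.zero_le _, hi.2⟩

end Coset

/-! ### Residues modulo q^m + 1 -/

section Residues

variable {h m n : ℕ}

theorem coprime_of_eq_pow_add_one {q : ℕ} (hm : 0 < m) (hn : n = q ^ m + 1) : q.Coprime n := by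
  rw [hn]
  have : (q ^ m).Coprime (q ^ m + 1) := by simp
  exact Nat.Coprime.coprime_dvd_left (dvd_pow_self q hm.ne') this

theorem orderOf_pos_of_coprime {q : ℕ} (hn : 0 < n) (hq : q.Coprime n) :
    0 < orderOf (q : ZMod n) := by
  have : NeZero n := ⟨hn.ne'⟩
  rw [orderOf_pos_iff, ← ZMod.coe_unitOfCoprime q hq]
  exact MonoidHom.isOfFinOrder (Units.coeHom _) (isOfFinOrder_of_finite (ZMod.unitOfCoprime q hq))

theorem residue_add {q s : ℕ} (hm : 0 < m) (hn : n = q ^ m + 1) (hs : ¬ n ∣ s) (i : ℕ) :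
    ((s * q ^ (i + m) % n : ℕ) : ℤ) = n - (s * q ^ i % n : ℕ) := by
  have hq := coprime_of_eq_pow_add_one hm hn
  have hn0 : 0 < n := by omega
  have hpos : ∀ i, 0 < s * q ^ i % n := fun i => by
    rw [Nat.pos_iff_ne_zero]
    intro h
    exact hs ((Nat.Coprime.pow_left i hq).symm.dvd_of_dvd_mul_right (Nat.dvd_of_mod_eq_zero h))
  have hsum : n ∣ s * q ^ i % n + s * q ^ (i + m) % n := by
    rw [Nat.dvd_iff_mod_eq_zero, ← Nat.add_mod, ← Nat.dvd_iff_mod_eq_zero]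
    exact ⟨s * q ^ i, by rw [hn, pow_add]; ring⟩
  obtain ⟨c, hc⟩ := hsum
  have l1 := Nat.mod_lt (s * q ^ i) hn0
  have l2 := Nat.mod_lt (s * q ^ (i + m)) hn0
  have p1 := hpos i
  have : c = 1 := by
    have c2 : c < 2 := by
      by_contra hc2
      nlinarith
    have c0 : c ≠ 0 := by rintro rfl; omega
    omega
  rw [this, mul_one] at hc
  rw [eq_sub_iff_add_eq, add_comm]
  exact_mod_cast hc

theorem dvd_residue_succ (q s i : ℕ) :
    (n : ℤ) ∣ q * (s * q ^ i % n : ℕ) - (s * q ^ (i + 1) % n : ℕ) := by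
  rw [← Int.modEq_iff_dvd]
  push_cast
  refine (Int.mod_modEq _ _).trans ?_
  rw [show (s : ℤ) * q ^ (i + 1) = q * (s * q ^ i) by ring]
  exact (Int.mod_modEq _ _).symm.mul_left _

/-- An orbit code is the residue sequence of its first term. -/
theorem OrbitCode.eq_residue {r : ℕ → ℤ} {b : ℕ → Bool} (H : OrbitCode h n r b) :
    ∃ s : ℕ, s < n ∧ ∀ i, r i = (s * (2 * h) ^ i % n : ℕ) := by
  have h0 := H.pos 0
  have h1 := H.lt 0
  refine ⟨(r 0).toNat, by omega, fun i => ?_⟩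
  push_cast
  rw [Int.toNat_of_nonneg h0.le]
  induction i with
  | zero => rw [pow_zero, mul_one, Int.emod_eq_of_lt h0.le h1]
  | succ i ih =>
    rw [← Int.emod_eq_of_lt (H.pos (i + 1)).le (H.lt (i + 1))]
    change _ ≡ _ [ZMOD n]
    rw [show r 0 * (2 * h) ^ (i + 1) = 2 * h * (r 0 * (2 * h) ^ i) by ring]
    refine Int.ModEq.trans ?_ ((Int.mod_modEq (r 0 * (2 * h) ^ i) n).mul_left _)
    rw [← ih, H.step i]
    exact Int.modEq_iff_dvd.2 ⟨h - 1 + if b i then 1 else 0, by ring⟩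

/-- The residue sequence `s * (2h)^i mod n`, as integers. -/
def residue (h n s : ℕ) (i : ℕ) : ℤ := (s * (2 * h) ^ i % n : ℕ)

theorem residue_inj {s l : ℕ} : residue h n s l = residue h n s 0 ↔
    s * (2 * h) ^ l % n = s % n := by
  simp only [residue, pow_zero, mul_one]
  exact Nat.cast_inj

theorem not_two_dvd (hm : 0 < m) (hn : n = (2 * h) ^ m + 1) : ¬ (2 : ℤ) ∣ n := by
  obtain ⟨k, rfl⟩ : ∃ k, m = k + 1 := ⟨m - 1, by omega⟩
  rw [hn, pow_succ]
  rintro ⟨c, hc⟩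
  have : (2 : ℤ) * ((2 * h) ^ k * h) + 1 = 2 * c := by
    push_cast at hc
    linear_combination hc
  omega

end Residues

/-! ### Coset sizes of the two largest leaders -/

section Leaders

variable {h m n : ℕ}

theorem residue_add_eq (hm : 0 < m) (hn : n = (2 * h) ^ m + 1) {s : ℕ} (hs : ¬ n ∣ s) (i : ℕ) :
    residue h n s (i + m) = n - residue h n s i :=
  residue_add hm hn hs i

theorem residue_shift {s l : ℕ} (hl : residue h n s l = residue h n s 0) (i : ℕ) :
    residue h n s (i + l) = residue h n s i := by
  have := residue_inj.1 hl
  simp only [residue]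
  rw [add_comm, ← mod_mul_pow_mod, this, Nat.mod_mul_mod]

/-- A residue negated by multiplication by `q ^ 2` has a coset of size four. -/
theorem card_cyclotomicCoset_of_antiperiod_two (hn0 : 0 < n) (hodd : ¬ (2 : ℤ) ∣ n)
    (hq : (2 * h).Coprime n) {s : ℕ}
    (hs : ∀ i, residue h n s (i + 2) = n - residue h n s i) :
    (cyclotomicCoset (2 * h) n s).card = 4 := by
  have ho := orderOf_pos_of_coprime hn0 hq
  have h4 : residue h n s 4 = residue h n s 0 := by rw [hs 2, hs 0]; ring
  have h4c : ∀ c i, residue h n s (i + 4 * c) = residue h n s i := fun c i => by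
    induction c with
    | zero => rfl
    | succ c ih => rw [mul_add, mul_one, ← add_assoc, residue_shift h4, ih]
  have hne : residue h n s 2 ≠ residue h n s 0 := fun e => by
    rw [hs 0] at e
    exact hodd ⟨residue h n s 0, by linarith⟩
  refine card_cyclotomicCoset ho hq (by norm_num) fun l => ?_
  rw [← residue_inj]
  constructor
  · intro hl
    have hg := periodic_gcd (z := residue h n s) (N := 4) (by norm_num) (residue_shift hl)
      (residue_shift h4)
    have hd := Nat.gcd_dvd_right l 4
    rw [← Nat.gcd_eq_right_iff_dvd]
    have hle := Nat.le_of_dvd (by norm_num) hd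
    generalize l.gcd 4 = g at hg hd hle ⊢
    interval_cases g
    · omega
    · exact absurd ((hg 1).trans (hg 0)) hne
    · exact absurd (hg 0) hne
    · omega
    · rfl
  · rintro ⟨c, rfl⟩
    simpa using h4c c 0

theorem isIthLargest_one {q a : ℕ} :
    IsIthLargestCosetLeader q n 1 a ↔ a ∈ minRep q n ∧ ∀ x ∈ minRep q n, x ≤ a := by
  simp [IsIthLargestCosetLeader, Finset.filter_eq_empty_iff]

/-- Above the second largest leader there is exactly one leader, the largest one. -/
theorem IsIthLargestCosetLeader.exists_largest {q a : ℕ} (ha : IsIthLargestCosetLeader q n 2 a) :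
    ∃ d, IsIthLargestCosetLeader q n 1 d ∧ a < d ∧ ∀ x ∈ minRep q n, a < x → x = d := by
  obtain ⟨ha1, ha2⟩ := ha
  obtain ⟨d, hd⟩ := Finset.card_eq_one.1
    (show ((minRep q n).filter fun b => a < b).card = 1 by omega)
  have hmem : ∀ x, (x ∈ minRep q n ∧ a < x) ↔ x = d := fun x => by
    rw [← Finset.mem_filter, hd, Finset.mem_singleton]
  have hd' := (hmem d).2 rfl
  refine ⟨d, isIthLargest_one.2 ⟨hd'.1, fun x hx => ?_⟩, hd'.2, fun x hx hax => (hmem x).1 ⟨hx, hax⟩⟩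
  by_contra hlt
  have := (hmem x).1 ⟨hx, by omega⟩
  omega

section Largest

variable {t : ℕ}

/-- The leaders above the start of a coded orbit are coded. -/
theorem exists_code_of_mem_minRep (hh : 0 < h) (hm : 0 < m) (hn : n = (2 * h) ^ m + 1) {a : ℕ}
    (ha : a ∈ minRep (2 * h) n) {w : ℕ → ℤ} {wb : ℕ → Bool} (Hw : OrbitCode h n w wb)
    (hwa : w 0 ≤ a) :
    ∃ b, OrbitCode h n (residue h n a) b ∧ Above wb b ∧ ∀ i, b (i + m) = !b i := by
  have hn0 : 0 < n := by omega
  have hq := coprime_of_eq_pow_add_one hm hn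
  have ho := orderOf_pos_of_coprime hn0 hq
  have hodd := not_two_dvd hm hn
  have hh' : (0 : ℤ) < h := by exact_mod_cast hh
  obtain ⟨han, hle⟩ := (mem_minRep hn0 ho).1 ha
  have hpos := Hw.pos 0
  have hnd : ¬ n ∣ a := fun hd => by
    have := Nat.le_of_dvd (by omega) hd
    omega
  have hanti := residue_add_eq hm hn hnd
  have lo : ∀ i, w 0 ≤ residue h n a i := fun i => hwa.trans (by
    simp only [residue]; exact_mod_cast hle i)
  have hi : ∀ i, residue h n a i ≤ n - w 0 := fun i => by
    have := lo (i + m)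
    rw [hanti] at this
    linarith
  have H := OrbitCode.of_bounds hh' hodd Hw (r := residue h n a)
    (fun i => by simpa [residue] using dvd_residue_succ (n := n) (2 * h) a i) lo hi
  refine ⟨_, H, H.above hh' Hw lo hi, fun i => ?_⟩
  simp only [hanti]
  rw [← decide_not]
  congr 1
  apply propext
  have : (2 : ℤ) * residue h n a i ≠ n := fun e => hodd ⟨_, e.symm⟩
  omega

/-- The orbit of 0011 repeated supplies a leader s ≤ a. The word of a therefore lies above 0011
repeated, which forces antiperiod two. -/
theorem largest_code (hh : 0 < h) (hm : m = 4 * t + 2) (hn : n = (2 * h) ^ m + 1) {a : ℕ}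
    (ha : IsIthLargestCosetLeader (2 * h) n 1 a) : 0 < a ∧
    ∃ b, OrbitCode h n (residue h n a) b ∧ ∀ i, b (i + 2) = !b i := by
  have hm0 : 0 < m := by omega
  have hn0 : 0 < n := by omega
  have hq := coprime_of_eq_pow_add_one hm0 hn
  have ho := orderOf_pos_of_coprime hn0 hq
  have hh' : (0 : ℤ) < h := by exact_mod_cast hh
  obtain ⟨r, Hr⟩ := OrbitCode.exists_of_antiperiodic hh' hm0 (fun i => decide (2 ≤ i % 4))
    (fun i => by
      rw [← decide_not]; congr 1; apply propext; omega)
  have en : (2 * (h : ℤ)) ^ m + 1 = n := by rw [hn]; push_cast; rfl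
  rw [en] at Hr
  obtain ⟨s, hs, hrs⟩ := Hr.eq_residue
  have r0 : r 0 = s := by rw [hrs, pow_zero, mul_one, Nat.mod_eq_of_lt hs]
  have hsm : s ∈ minRep (2 * h) n := (mem_minRep hn0 ho).2 ⟨hs, fun i => by
    have := (Hr.double_bounds hh' i).1
    rw [r0, hrs i] at this
    exact_mod_cast this⟩
  have hsa := (isIthLargest_one.1 ha).2 s hsm
  have hs0 := Hr.pos 0
  refine ⟨by omega, ?_⟩
  obtain ⟨b, H, hA, hb⟩ := exists_code_of_mem_minRep hh hm0 hn (isIthLargest_one.1 ha).1 Hr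
    (by rw [r0]; exact_mod_cast hsa)
  exact ⟨b, H, antiperiod_two_of_above (by simp) (by simp) (by simp) (by simp) hA hm0
    ⟨2 * t + 1, by omega⟩ hb⟩

theorem card_largest (hh : 0 < h) (hm : m = 4 * t + 2) (hn : n = (2 * h) ^ m + 1) {a : ℕ}
    (ha : IsIthLargestCosetLeader (2 * h) n 1 a) : (cyclotomicCoset (2 * h) n a).card = 4 := by
  obtain ⟨-, b, H, hb⟩ := largest_code hh hm hn ha
  exact card_cyclotomicCoset_of_antiperiod_two (by omega) (not_two_dvd (by omega) hn)
    (coprime_of_eq_pow_add_one (by omega) hn) (H.antiperiodic (by exact_mod_cast hh) hb)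

theorem card_second (hh : 0 < h) (hm : m = 4 * t + 2) (hn : n = (2 * h) ^ m + 1) {a : ℕ}
    (ha : IsIthLargestCosetLeader (2 * h) n 2 a) (ha0 : 0 < a) :
    (cyclotomicCoset (2 * h) n a).card = 2 * m := by
  have hm0 : 0 < m := by omega
  have hn0 : 0 < n := by omega
  have hq := coprime_of_eq_pow_add_one hm0 hn
  have ho := orderOf_pos_of_coprime hn0 hq
  have hodd := not_two_dvd hm0 hn
  have hh' : (0 : ℤ) < h := by exact_mod_cast hh
  obtain ⟨han, hale⟩ := (mem_minRep hn0 ho).1 ha.1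
  have hnd : ¬ n ∣ a := fun hd => by
    have := Nat.le_of_dvd ha0 hd
    omega
  have hanti := residue_add_eq hm0 hn hnd
  -- For t = 0, multiplication by q^2 = q^m already negates residues, so the size is 4 = 2m.
  rcases Nat.eq_zero_or_pos t with rfl | ht
  · obtain rfl : m = 2 := by omega
    exact card_cyclotomicCoset_of_antiperiod_two hn0 hodd hq hanti
  obtain ⟨d, hd, had, huniq⟩ := ha.exists_largest
  obtain ⟨hd0, bd, Hd, hbd⟩ := largest_code hh hm hn hd
  obtain ⟨r, Hr⟩ := OrbitCode.exists_of_antiperiodic hh' hm0 (topWord m)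
    (fun i => by rw [hm, topWord_add])
  have en : (2 * (h : ℤ)) ^ m + 1 = n := by rw [hn]; push_cast; rfl
  rw [en] at Hr
  obtain ⟨s, hs, hrs⟩ := Hr.eq_residue
  have r0 : r 0 = s := by rw [hrs, pow_zero, mul_one, Nat.mod_eq_of_lt hs]
  have hsm : s ∈ minRep (2 * h) n := (mem_minRep hn0 ho).2 ⟨hs, fun i => by
    have := (OrbitCode.topWord_bounds hh' ht (hm ▸ Hr) i).1
    rw [r0, hrs i] at this
    exact_mod_cast this⟩
  -- The word of d has antiperiod two, whereas `topWord` has the bit 0 at both positions 1 and 3.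
  have hsd : s ≠ d := by
    rintro rfl
    have e : ∀ i, topWord m i = bd i := fun i => by
      rw [Bool.eq_iff_iff, Hr.bit_iff hh', Hd.bit_iff hh', hrs]
      rfl
    have := hbd 1
    rw [← e, ← e, hm, topWord_one (by omega), topWord_false le_rfl (by omega) (by norm_num)] at this
    simp at this
  have hsa : s ≤ a := by
    by_contra hlt
    exact hsd (huniq s hsm (by omega))
  obtain ⟨b, H, hA, hb⟩ := exists_code_of_mem_minRep hh hm0 hn ha.1 Hr
    (by rw [r0]; exact_mod_cast hsa)
  have res0 : ∀ {x}, x ∈ minRep (2 * h) n → residue h n x 0 = x ∧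
      ∀ i, residue h n x 0 ≤ residue h n x i := fun {x} hx => by
    obtain ⟨h1, h2⟩ := (mem_minRep hn0 ho).1 hx
    have e : residue h n x 0 = x := by
      rw [residue, pow_zero, mul_one, Nat.mod_eq_of_lt h1]
    refine ⟨e, fun i => ?_⟩
    rw [e, residue]
    exact_mod_cast h2 i
  have hb2 : ¬ ∀ i, b (i + 2) = !b i := fun hb2 => by
    have := OrbitCode.eq_of_antiperiod_two hh' H Hd hb2 hbd (res0 ha.1).2 (res0 hd.1).2
    rw [(res0 ha.1).1, (res0 hd.1).1] at this
    omega
  have h2m : residue h n a (2 * m) = residue h n a 0 := by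
    rw [two_mul, hanti]
    have := hanti 0
    rw [zero_add] at this
    rw [this]; ring
  refine card_cyclotomicCoset ho hq (by omega) fun l => ?_
  rw [← residue_inj]
  constructor
  · intro hl
    have hg := periodic_gcd (z := residue h n a) (N := 2 * m) (by omega) (residue_shift hl)
      (residue_shift h2m)
    have hgb : ∀ i, b (i + l.gcd (2 * m)) = b i := fun i => by
      rw [Bool.eq_iff_iff, H.bit_iff hh', H.bit_iff hh', hg]
    subst hm
    have := hA.period_eq ht hb hb2 hgb (Nat.gcd_dvd_right _ _)
    rw [← this]
    exact Nat.gcd_dvd_left _ _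
  · rintro ⟨c, rfl⟩
    induction c with
    | zero => rfl
    | succ c ih => rw [mul_add, mul_one, residue_shift h2m, ih]

end Largest

/-! ### Counting residues with large leader -/

section Count

variable {q : ℕ}

/-- The residues with leader at least `δ` form the coset of the only such leader. -/
theorem filter_leader_eq_coset (hn : 0 < n) (ho : 0 < orderOf (q : ZMod n)) {d δ : ℕ}
    (hd : d ∈ minRep q n) (hδ : ∀ x ∈ minRep q n, δ ≤ x ↔ x = d) :
    ((Finset.range n).filter fun j => δ ≤ cosetLeader q n j) = cyclotomicCoset q n d := by
  ext j
  simp only [Finset.mem_filter, Finset.mem_range]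
  constructor
  · rintro ⟨hj, h⟩
    exact (mem_cyclotomicCoset_iff hn ho hd hj).2
      ((hδ _ (cosetLeader_mem_minRep hn ho j)).1 h)
  · intro h
    have hj := lt_of_mem_cyclotomicCoset hn h
    exact ⟨hj, (hδ _ (cosetLeader_mem_minRep hn ho j)).2
      ((mem_cyclotomicCoset_iff hn ho hd hj).1 h)⟩

theorem card_filter_leader_pair (hn : 0 < n) (ho : 0 < orderOf (q : ZMod n)) {d e δ : ℕ}
    (hd : d ∈ minRep q n) (he : e ∈ minRep q n) (hde : d ≠ e)
    (hδ : ∀ x ∈ minRep q n, δ ≤ x ↔ x = d ∨ x = e) :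
    ((Finset.range n).filter fun j => δ ≤ cosetLeader q n j).card =
      (cyclotomicCoset q n d).card + (cyclotomicCoset q n e).card := by
  rw [← Finset.card_union_of_disjoint]
  · congr 1
    ext j
    simp only [Finset.mem_filter, Finset.mem_range, Finset.mem_union]
    constructor
    · rintro ⟨hj, h⟩
      rw [mem_cyclotomicCoset_iff hn ho hd hj, mem_cyclotomicCoset_iff hn ho he hj]
      exact (hδ _ (cosetLeader_mem_minRep hn ho j)).1 h
    · intro h
      have hj : j < n := h.elim (lt_of_mem_cyclotomicCoset hn) (lt_of_mem_cyclotomicCoset hn)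
      rw [mem_cyclotomicCoset_iff hn ho hd hj, mem_cyclotomicCoset_iff hn ho he hj] at h
      exact ⟨hj, (hδ _ (cosetLeader_mem_minRep hn ho j)).2 h⟩
  · rw [Finset.disjoint_left]
    intro j h1 h2
    have hj := lt_of_mem_cyclotomicCoset hn h1
    rw [mem_cyclotomicCoset_iff hn ho hd hj] at h1
    rw [mem_cyclotomicCoset_iff hn ho he hj] at h2
    exact hde (h1.symm.trans h2)

open Classical in
theorem card_filter_notMem_zero (hn : 0 < n) (ho : 0 < orderOf (q : ZMod n)) {δ : ℕ} :
    ((Finset.range n).filter fun j => ∀ i ∈ Finset.Ico 0 δ, j ∉ cyclotomicCoset q n i).card =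
      ((Finset.range n).filter fun j => δ ≤ cosetLeader q n j).card := by
  congr 1
  ext j
  simp only [Finset.mem_filter, Finset.mem_range]
  exact and_congr_right fun hj => forall_notMem_cyclotomicCoset_iff hn ho hj

open Classical in
theorem card_filter_notMem_one (hn : 0 < n) (ho : 0 < orderOf (q : ZMod n)) (hq : q.Coprime n)
    {δ : ℕ} (hδ0 : 0 < δ) (hδ : δ ≤ n) :
    ((Finset.range n).filter fun j => ∀ i ∈ Finset.Ico 1 δ, j ∉ cyclotomicCoset q n i).card =
      ((Finset.range n).filter fun j => δ ≤ cosetLeader q n j).card + 1 := by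
  have h0 : cosetLeader q n 0 = 0 := by
    have := cosetLeader_le (self_mem_cyclotomicCoset ho hn)
    omega
  rw [← Finset.card_insert_of_notMem (a := 0)
    (s := (Finset.range n).filter fun j => δ ≤ cosetLeader q n j) (by simp [h0]; omega)]
  congr 1
  ext j
  simp only [Finset.mem_filter, Finset.mem_range, Finset.mem_insert]
  rw [and_congr_right fun hj => forall_notMem_cyclotomicCoset_iff_one hn ho hq hδ hj]
  constructor
  · rintro ⟨h1, h2 | h2⟩
    · exact Or.inl h2
    · exact Or.inr ⟨h1, h2⟩
  · rintro (h | ⟨h1, h2⟩)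
    · exact ⟨by omega, Or.inl h⟩
    · exact ⟨h1, Or.inr h2⟩

theorem IsIthLargestCosetLeader.le_iff_second {a d δ : ℕ}
    (hd : IsIthLargestCosetLeader q n 1 d) (ha : IsIthLargestCosetLeader q n 2 a)
    (h1 : a + 1 ≤ δ) (h2 : δ ≤ d) : ∀ x ∈ minRep q n, δ ≤ x ↔ x = d := by
  intro x hx
  obtain ⟨d', -, -, hu⟩ := ha.exists_largest
  constructor
  · intro h
    rw [hu x hx (by omega), hu d hd.1 (by omega)]
  · rintro rfl; exact h2

theorem IsIthLargestCosetLeader.le_iff_third {c a d δ : ℕ}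
    (hd : IsIthLargestCosetLeader q n 1 d) (ha : IsIthLargestCosetLeader q n 2 a)
    (hc : IsIthLargestCosetLeader q n 3 c) (had : a < d)
    (h1 : c + 1 ≤ δ) (h2 : δ ≤ a) : ∀ x ∈ minRep q n, δ ≤ x ↔ x = d ∨ x = a := by
  have hcard : ((minRep q n).filter fun b => c < b).card = 2 := by have := hc.2; omega
  have hsub : {d, a} ⊆ (minRep q n).filter fun b => c < b := by
    intro x hx
    simp only [Finset.mem_insert, Finset.mem_singleton] at hx
    rcases hx with rfl | rfl
    · exact Finset.mem_filter.2 ⟨hd.1, by omega⟩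
    · exact Finset.mem_filter.2 ⟨ha.1, by omega⟩
  have heq := Finset.eq_of_subset_of_card_le hsub (by
    rw [hcard, Finset.card_pair (by omega)])
  intro x hx
  constructor
  · intro h
    have : x ∈ (minRep q n).filter fun b => c < b := Finset.mem_filter.2 ⟨hx, by omega⟩
    rw [← heq] at this
    simpa using this
  · rintro (rfl | rfl) <;> omega

end Count

end Leaders

/-! ### Minimal polynomials over finite fields -/

section MinimalPolynomials

variable {K : Type*} [Field K] [Fintype K] {L : Type*} [Field L] [Algebra K L]

theorem aeval_pow_card_pow (p : K[X]) (x : L) (k : ℕ) :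
    aeval (x ^ Fintype.card K ^ k) p = aeval x p ^ Fintype.card K ^ k := by
  induction k with
  | zero => simp
  | succ k ih =>
    rw [pow_succ, pow_mul, pow_mul, ← ih, ← expand_aeval, FiniteField.expand_card, map_pow]

/-- The roots of the minimal polynomial of `x` over a finite field are its Frobenius conjugates. -/
theorem aeval_minpoly_eq_zero_iff {x y : L} (hx : IsIntegral K x) :
    aeval y (minpoly K x) = 0 ↔ ∃ k, y = x ^ Fintype.card K ^ k := by
  constructor
  · intro h
    have hy : IsIntegral K y := ⟨minpoly K x, minpoly.monic hx, h⟩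
    -- L may be infinite. In the finite field generated by x and y, conjugates differ by an
    -- automorphism, which is a power of Frobenius.
    let F := IntermediateField.adjoin K ({x, y} : Set L)
    have : FiniteDimensional K F := IntermediateField.finiteDimensional_adjoin (by
      rintro z (rfl | rfl) <;> assumption)
    have : Finite F := Module.finite_of_finite K
    let x' : F := ⟨x, IntermediateField.subset_adjoin K _ (by simp)⟩
    let y' : F := ⟨y, IntermediateField.subset_adjoin K _ (by simp)⟩
    have hx' : minpoly K x' = minpoly K x := (IntermediateField.minpoly_eq x')
    have hy' : minpoly K y' = minpoly K y := (IntermediateField.minpoly_eq y')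
    have hxy : minpoly K x = minpoly K y :=
      minpoly.eq_of_irreducible_of_monic (minpoly.irreducible hx) h (minpoly.monic hx)
    have hconj : IsConjRoot K y' x' := by rw [isConjRoot_def, hx', hy', hxy]
    obtain ⟨σ, hσ⟩ := isConjRoot_iff_exists_algEquiv.1 hconj
    obtain ⟨k, hk⟩ := (FiniteField.bijective_frobeniusAlgEquivOfAlgebraic_pow K F).2 σ
    refine ⟨k, ?_⟩
    rw [← hk] at hσ
    simp only [AlgEquiv.coe_pow,
      FiniteField.coe_frobeniusAlgEquivOfAlgebraic_iterate] at hσ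
    have := congrArg (Subtype.val : F → L) hσ
    simpa [x', y'] using this.symm
  · rintro ⟨k, rfl⟩
    rw [aeval_pow_card_pow, minpoly.aeval, zero_pow]
    exact pow_ne_zero _ Fintype.card_ne_zero

end MinimalPolynomials

/-! ### Cyclic codes and the BCH bound -/

section VecToPoly

variable {K : Type*} [Field K] {L : Type*} [Field L] [Algebra K L] {n : ℕ}

theorem vecToPoly_apply (c : Fin n → K) : vecToPoly K n c = ∑ i : Fin n, monomial (i : ℕ) (c i) := by
  simp [vecToPoly]

theorem aeval_vecToPoly (c : Fin n → K) (x : L) :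
    aeval x (vecToPoly K n c) = ∑ i, algebraMap K L (c i) * x ^ (i : ℕ) := by
  simp [vecToPoly_apply, aeval_monomial]

theorem exists_vecToPoly_eq {p : K[X]} (hp : p.degree < n) : ∃ c, vecToPoly K n c = p := by
  refine ⟨fun i => p.coeff i, ?_⟩
  rw [vecToPoly_apply, Fin.sum_univ_eq_sum_range fun i => monomial i (p.coeff i)]
  by_cases h0 : p = 0
  · simp [h0]
  · exact (p.as_sum_range' n ((natDegree_lt_iff_degree_lt h0).2 hp)).symm

theorem mem_cyclicCode {g : K[X]} (hg : g ∣ X ^ n - 1) {c : Fin n → K} :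
    c ∈ cyclicCode n g ↔ g ∣ vecToPoly K n c := by
  simp only [cyclicCode, Submodule.mem_comap, LinearMap.comp_apply, AlgHom.toLinearMap_apply,
    Submodule.restrictScalars_mem, Ideal.Quotient.mkₐ_eq_mk, Ideal.mem_span_singleton]
  constructor
  · rintro ⟨a, ha⟩
    obtain ⟨a, rfl⟩ := Ideal.Quotient.mk_surjective a
    rw [← map_mul, Ideal.Quotient.eq, Ideal.mem_span_singleton] at ha
    have := (hg.trans ha).add (dvd_mul_right g a)
    rwa [sub_add_cancel] at this
  · rintro ⟨a, ha⟩
    exact ⟨Ideal.Quotient.mk _ a, by rw [ha, map_mul]⟩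

/-- The dimension of the cyclic code generated by a divisor of `X ^ n - 1`. -/
theorem finrank_cyclicCode (hn : 0 < n) {g : K[X]} (hg : g ∣ X ^ n - 1) :
    Module.finrank K (cyclicCode n g) + g.natDegree = n := by
  have hX : (X ^ n - 1 : K[X]) ≠ 0 := by
    simpa using X_pow_sub_C_ne_zero hn (1 : K)
  have hg0 : g ≠ 0 := ne_zero_of_dvd_ne_zero hX hg
  have hdeg : g.natDegree ≤ n := by
    have := natDegree_le_of_dvd hg hX
    rwa [show (X ^ n - 1 : K[X]) = X ^ n - C 1 by simp, natDegree_X_pow_sub_C] at this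
  let φ : (Fin n → K) →ₗ[K] (K[X] ⧸ Ideal.span {g}) :=
    (Ideal.Quotient.mkₐ K (Ideal.span {g})).toLinearMap ∘ₗ vecToPoly K n
  have hker : LinearMap.ker φ = cyclicCode n g := by
    ext c
    rw [mem_cyclicCode hg, LinearMap.mem_ker]
    simp only [φ, LinearMap.comp_apply, AlgHom.toLinearMap_apply, Ideal.Quotient.mkₐ_eq_mk]
    rw [Ideal.Quotient.eq_zero_iff_mem, Ideal.mem_span_singleton]
  have hsurj : Function.Surjective φ := by
    intro y
    obtain ⟨p, rfl⟩ := Ideal.Quotient.mk_surjective y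
    obtain ⟨c, hc⟩ := exists_vecToPoly_eq (n := n) (p := p % g)
      ((EuclideanDomain.mod_lt p hg0).trans_le (by
        rw [degree_eq_natDegree hg0]; exact_mod_cast hdeg))
    refine ⟨c, ?_⟩
    simp only [φ, LinearMap.comp_apply, AlgHom.toLinearMap_apply, Ideal.Quotient.mkₐ_eq_mk, hc]
    rw [Ideal.Quotient.eq, Ideal.mem_span_singleton]
    exact ⟨-(p / g), by rw [← sub_eq_zero]; linear_combination EuclideanDomain.div_add_mod p g⟩
  have := LinearMap.finrank_range_add_finrank_ker φ
  rw [LinearMap.range_eq_top.2 hsurj, finrank_top, hker, finrank_quotient_span_eq_natDegree,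
    Module.finrank_fin_fun] at this
  omega

/-- The BCH bound: a nonzero vector with `d - 1` consecutive zeros has weight at least `d`. -/
theorem le_hammingNorm_of_consecutive_zeros [DecidableEq K] {β : L} (hβ : IsPrimitiveRoot β n)
    {c : Fin n → K} (hc : c ≠ 0) (e d : ℕ)
    (hz : ∀ k, k + 1 < d → aeval (β ^ (e + k)) (vecToPoly K n c) = 0) : d ≤ hammingNorm c := by
  by_contra hlt
  rw [not_le] at hlt
  set S : Finset (Fin n) := Finset.univ.filter fun i => c i ≠ 0 with hS
  have hw : hammingNorm c = S.card := rfl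
  rw [hw] at hlt
  let E := S.equivFin.symm
  have hinj : Function.Injective fun j : Fin S.card => β ^ ((E j : Fin n) : ℕ) := by
    intro j k hjk
    have := hβ.pow_inj (E j : Fin n).2 (E k : Fin n).2 hjk
    exact E.injective (Subtype.ext (Fin.ext this))
  have hβ0 : β ≠ 0 := by
    rcases Nat.eq_zero_or_pos n with rfl | hn
    · exact absurd (Subsingleton.elim c 0) hc
    · exact hβ.ne_zero hn.ne'
  -- Vandermonde on the support: the starting exponent e is absorbed into the unknowns, which leaves
  -- the powers 0, …, |S| - 1 of the distinct nodes β^i.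
  have key := Matrix.eq_zero_of_forall_pow_sum_mul_pow_eq_zero hinj
    (v := fun j => algebraMap K L (c (E j)) * β ^ (((E j : Fin n) : ℕ) * e)) (fun k => by
      have h := hz k (by have := k.2; omega)
      rw [aeval_vecToPoly, ← Finset.sum_subset (Finset.subset_univ S), ← Finset.sum_coe_sort,
        ← E.sum_comp] at h
      · rw [← h]
        refine Finset.sum_congr rfl fun j _ => ?_
        rw [mul_assoc, ← pow_mul, ← pow_mul, ← pow_add]
        congr 2
        ring
      · intro i _ hi
        have : c i = 0 := by simpa [hS] using hi
        simp [this])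
  obtain ⟨i, hi⟩ : ∃ i, c i ≠ 0 := Function.ne_iff.1 hc
  have hiS : i ∈ S := by simpa [hS] using hi
  have := congrFun key (E.symm ⟨i, hiS⟩)
  simp [hi, hβ0] at this

theorem le_minDist {C : Submodule K (Fin n → K)} (hC : 0 < Module.finrank K C) {d : ℕ}
    (h : ∀ [DecidableEq K], ∀ c ∈ C, c ≠ 0 → d ≤ hammingNorm c) : d ≤ minDist C := by
  classical
  have hne : C ≠ ⊥ := by
    rintro rfl
    simp at hC
  obtain ⟨x, hx, hx0⟩ := Submodule.exists_mem_ne_zero_of_ne_bot hne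
  refine le_csInf ⟨_, x, hx, 0, C.zero_mem, hx0, rfl⟩ ?_
  rintro _ ⟨x, hx, y, hy, hxy, rfl⟩
  rw [hammingDist_eq_hammingNorm]
  exact h _ (C.add_mem (C.neg_mem hx) hy) (by
    rw [neg_add_eq_sub, sub_ne_zero]; exact hxy.symm)

end VecToPoly

/-! ### Zeros and degree of the generator polynomial -/

section Generator

variable {K : Type*} [Field K] {L : Type*} [Field L] [Algebra K L] {n : ℕ} {β : L}

theorem isIntegral_pow_of_isPrimitiveRoot (hn : 0 < n) (hβ : IsPrimitiveRoot β n) (i : ℕ) :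
    IsIntegral K (β ^ i) :=
  IsIntegral.pow ⟨X ^ n - 1, monic_X_pow_sub_C 1 hn.ne', by simp [hβ.pow_eq_one]⟩ i

theorem genPoly_dvd_iff {δ b : ℕ} {p : K[X]} :
    genPoly K β δ b ∣ p ↔ ∀ i ∈ Finset.Ico b (b + δ - 1), aeval (β ^ i) p = 0 := by
  classical
  let _ : NormalizedGCDMonoid K[X] := UniqueFactorizationMonoid.toNormalizedGCDMonoid K[X]
  refine Iff.trans (Finset.lcm_dvd_iff (f := fun i => minpoly K (β ^ i))) ?_
  exact forall₂_congr fun i _ => minpoly.dvd_iff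

theorem aeval_genPoly {δ b i : ℕ} (hi : i ∈ Finset.Ico b (b + δ - 1)) :
    aeval (β ^ i) (genPoly K β δ b) = 0 :=
  genPoly_dvd_iff.1 dvd_rfl i hi

theorem genPoly_dvd_X_pow_sub_one (hβ : IsPrimitiveRoot β n) (δ b : ℕ) :
    genPoly K β δ b ∣ X ^ n - 1 :=
  genPoly_dvd_iff.2 fun i _ => by
    simp [← pow_mul, mul_comm i, pow_mul β n, hβ.pow_eq_one]

theorem mem_bchCode (hβ : IsPrimitiveRoot β n) {δ b : ℕ} {c : Fin n → K} :
    c ∈ bchCode K β n δ b ↔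
      ∀ i ∈ Finset.Ico b (b + δ - 1), aeval (β ^ i) (vecToPoly K n c) = 0 := by
  rw [bchCode, mem_cyclicCode (genPoly_dvd_X_pow_sub_one hβ δ b), genPoly_dvd_iff]

variable [Fintype K]

theorem aeval_genPoly_eq_zero_iff (hn : 0 < n) (hβ : IsPrimitiveRoot β n)
    (ho : 0 < orderOf (Fintype.card K : ZMod n)) {δ b j : ℕ} (hj : j < n) :
    aeval (β ^ j) (genPoly K β δ b) = 0 ↔
      ∃ i ∈ Finset.Ico b (b + δ - 1), j ∈ cyclotomicCoset (Fintype.card K) n i := by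
  have hroot : ∀ i, aeval (β ^ j) (minpoly K (β ^ i)) = 0 ↔
      j ∈ cyclotomicCoset (Fintype.card K) n i := fun i => by
    rw [aeval_minpoly_eq_zero_iff (isIntegral_pow_of_isPrimitiveRoot hn hβ i),
      mem_cyclotomicCoset ho]
    refine exists_congr fun k => ?_
    rw [← pow_mul, ← pow_mod_orderOf β (i * _), ← hβ.eq_orderOf]
    exact ⟨fun h => (hβ.pow_inj hj (Nat.mod_lt _ hn) h).symm, fun h => by rw [h]⟩
  constructor
  · intro h
    have hd : genPoly K β δ b ∣ ∏ i ∈ Finset.Ico b (b + δ - 1), minpoly K (β ^ i) :=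
      genPoly_dvd_iff.2 fun i hi => by
        rw [map_prod]
        exact Finset.prod_eq_zero hi (minpoly.aeval K _)
    obtain ⟨a, ha⟩ := hd
    have h0 : aeval (β ^ j) (∏ i ∈ Finset.Ico b (b + δ - 1), minpoly K (β ^ i)) = 0 := by
      rw [ha, map_mul, h, zero_mul]
    rw [map_prod, Finset.prod_eq_zero_iff] at h0
    obtain ⟨i, hi, h0⟩ := h0
    exact ⟨i, hi, (hroot i).1 h0⟩
  · rintro ⟨i, hi, hmem⟩
    obtain ⟨a, ha⟩ := minpoly.dvd K (β ^ i) (aeval_genPoly (K := K) hi)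
    rw [ha, map_mul, (hroot i).2 hmem, zero_mul]

-- As n is nonzero in K and L contains β, the generator is separable and splits, so its degree is
-- its number of roots among the powers of β.
open Classical in
theorem natDegree_genPoly (hn : 0 < n) (hnK : (n : K) ≠ 0) (hβ : IsPrimitiveRoot β n)
    (ho : 0 < orderOf (Fintype.card K : ZMod n)) (δ b : ℕ) :
    (genPoly K β δ b).natDegree = ((Finset.range n).filter fun j =>
      ∃ i ∈ Finset.Ico b (b + δ - 1), j ∈ cyclotomicCoset (Fintype.card K) n i).card := by
  have hd := genPoly_dvd_X_pow_sub_one (K := K) hβ δ b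
  have hX : (X ^ n - 1 : K[X]) ≠ 0 := by
    simpa using X_pow_sub_C_ne_zero hn (1 : K)
  have hXL : (X ^ n - 1 : L[X]) ≠ 0 := by
    simpa using X_pow_sub_C_ne_zero hn (1 : L)
  have hsep : (genPoly K β δ b).Separable := (X_pow_sub_one_separable_iff.2 hnK).of_dvd hd
  have hspl : ((genPoly K β δ b).map (algebraMap K L)).Splits := by
    refine Splits.of_dvd (g := X ^ n - 1) (by simpa using X_pow_sub_one_splits hβ) hXL ?_
    simpa using Polynomial.map_dvd (algebraMap K L) hd
  have hG : genPoly K β δ b ≠ 0 := ne_zero_of_dvd_ne_zero hX hd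
  rw [← card_rootSet_eq_natDegree hsep hspl, ← Nat.card_eq_fintype_card, Nat.card_coe_set_eq,
    ← Set.ncard_coe_finset, eq_comm]
  refine Set.ncard_congr (fun j _ => β ^ j) ?_ ?_ ?_
  · intro j hj
    simp only [Finset.coe_filter, Finset.mem_range, Set.mem_ofPred_eq] at hj
    exact (mem_rootSet_of_ne hG).2 ((aeval_genPoly_eq_zero_iff hn hβ ho hj.1).2 hj.2)
  · intro i j hi hj h
    simp only [Finset.coe_filter, Finset.mem_range, Set.mem_ofPred_eq] at hi hj
    exact hβ.pow_inj hi.1 hj.1 h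
  · intro x hx
    have hx0 := (mem_rootSet_of_ne hG).1 hx
    obtain ⟨a, ha⟩ := hd
    have hx1 : aeval x (X ^ n - 1 : K[X]) = 0 := by rw [ha, map_mul, hx0, zero_mul]
    have : NeZero n := ⟨hn.ne'⟩
    obtain ⟨j, hj, rfl⟩ := hβ.eq_pow_of_pow_eq_one (ξ := x) (by
      simpa [sub_eq_zero] using hx1)
    refine ⟨j, ?_, rfl⟩
    simp only [Finset.coe_filter, Finset.mem_range, Set.mem_ofPred_eq]
    exact ⟨hj, (aeval_genPoly_eq_zero_iff hn hβ ho hj).1 hx0⟩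

open Classical in
theorem finrank_bchCode (hn : 0 < n) (hnK : (n : K) ≠ 0) (hβ : IsPrimitiveRoot β n)
    (ho : 0 < orderOf (Fintype.card K : ZMod n)) (δ b : ℕ) :
    Module.finrank K (bchCode K β n δ b) = ((Finset.range n).filter fun j =>
      ∀ i ∈ Finset.Ico b (b + δ - 1), j ∉ cyclotomicCoset (Fintype.card K) n i).card := by
  have h1 := finrank_cyclicCode hn (genPoly_dvd_X_pow_sub_one (K := K) hβ δ b)
  have h2 := Finset.card_filter_add_card_filter_not (s := Finset.range n) fun j =>
      ∃ i ∈ Finset.Ico b (b + δ - 1), j ∈ cyclotomicCoset (Fintype.card K) n i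
  rw [natDegree_genPoly hn hnK hβ ho] at h1
  rw [Finset.card_range] at h2
  have h3 : ((Finset.range n).filter fun j => ¬ ∃ i ∈ Finset.Ico b (b + δ - 1),
      j ∈ cyclotomicCoset (Fintype.card K) n i) = (Finset.range n).filter fun j =>
      ∀ i ∈ Finset.Ico b (b + δ - 1), j ∉ cyclotomicCoset (Fintype.card K) n i := by
    ext j
    simp only [Finset.mem_filter, not_exists, not_and]
  rw [h3] at h2
  rw [bchCode]
  omega

end Generator

/-! ### Duals of cyclic codes and the LCD property -/

section Duality

variable {K : Type*} [Field K] {L : Type*} [Field L] [Algebra K L] {n : ℕ} {β : L}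

/-- The functional pairing `c` with the reduction of a polynomial modulo `X ^ n - 1`. -/
noncomputable def pairing (c : Fin n → K) (L : Type*) [Field L] [Algebra K L] : L[X] →ₗ[L] L :=
  (∑ i : Fin n, algebraMap K L (c i) • lcoeff L (i : ℕ)) ∘ₗ modByMonicHom (X ^ n - 1 : L[X])

theorem pairing_apply (c : Fin n → K) (p : L[X]) :
    pairing c L p = ∑ i : Fin n, algebraMap K L (c i) * (p %ₘ (X ^ n - 1)).coeff i := by
  simp [pairing, modByMonicHom, Algebra.smul_def]

theorem pairing_mul_eq_zero (hn : 0 < n) {g : K[X]} (hg : g ∣ X ^ n - 1) {c : Fin n → K}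
    (hc : c ∈ dualCode (cyclicCode n g)) (f : L[X]) :
    pairing c L (f * g.map (algebraMap K L)) = 0 := by
  have hmon : (X ^ n - 1 : K[X]).Monic := monic_X_pow_sub_C 1 hn.ne'
  have hmono : ∀ a, pairing c L (X ^ a * g.map (algebraMap K L)) = 0 := fun a => by
    have hmap : (X ^ a * g.map (algebraMap K L)) %ₘ (X ^ n - 1) =
        ((X ^ a * g) %ₘ (X ^ n - 1)).map (algebraMap K L) := by
      rw [map_modByMonic _ hmon]
      simp
    have hd : g ∣ (X ^ a * g) %ₘ (X ^ n - 1) := by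
      rw [modByMonic_eq_sub_mul_div]
      exact dvd_sub (dvd_mul_left _ _) (hg.mul_right _)
    obtain ⟨d, hdv⟩ := exists_vecToPoly_eq (n := n) (p := (X ^ a * g) %ₘ (X ^ n - 1)) (by
      refine (degree_modByMonic_lt _ hmon).trans_le ?_
      rw [show (X ^ n - 1 : K[X]) = X ^ n - C 1 by simp, degree_X_pow_sub_C hn])
    have hdC : d ∈ cyclicCode n g := (mem_cyclicCode hg).2 (hdv ▸ hd)
    have hdot : c ⬝ᵥ d = 0 := hc d hdC
    have hcoeff : ∀ i : Fin n, ((X ^ a * g) %ₘ (X ^ n - 1)).coeff i = d i := fun i => by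
      rw [← hdv, vecToPoly_apply, finsetSum_coeff]
      simp only [coeff_monomial]
      simp [Fin.val_inj]
    rw [pairing_apply, hmap]
    simp only [coeff_map, hcoeff, ← map_mul, ← map_sum]
    rw [← map_zero (algebraMap K L), ← hdot]
    rfl
  induction f using Polynomial.induction_on' with
  | add p q hp hq => rw [add_mul, map_add, hp, hq, add_zero]
  | monomial a r =>
    rw [← C_mul_X_pow_eq_monomial, mul_assoc, ← smul_eq_C_mul, map_smul, hmono, smul_zero]

/-- The polynomial H = ∑ (yX)^i satisfies X H ≡ y⁻¹ H modulo X^n - 1, hence H g ≡ g(y⁻¹) H. Pairing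
c with H evaluates c at y, and pairing c with H g gives 0. -/
theorem aeval_vecToPoly_eq_zero_of_mem_dualCode (hn : 0 < n) {g : K[X]} (hg : g ∣ X ^ n - 1)
    {c : Fin n → K} (hc : c ∈ dualCode (cyclicCode n g)) {y : L} (hy : y ^ n = 1)
    (hgy : aeval y⁻¹ g ≠ 0) : aeval y (vecToPoly K n c) = 0 := by
  have hmon : (X ^ n - 1 : L[X]).Monic := monic_X_pow_sub_C 1 hn.ne'
  have hy0 : y ≠ 0 := by rintro rfl; rw [zero_pow hn.ne'] at hy; exact zero_ne_one hy
  set H : L[X] := ∑ i ∈ Finset.range n, (C y * X) ^ i with hH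
  have hHX : H * (X - C y⁻¹) = C y⁻¹ * (X ^ n - 1) := by
    have h1 : H * (C y * X - 1) = (C y * X) ^ n - 1 := geom_sum_mul _ _
    rw [mul_pow, ← C_pow, hy, C_1, one_mul] at h1
    rw [← h1, show (X - C y⁻¹ : L[X]) = C y⁻¹ * (C y * X - 1) by
      rw [mul_sub, ← mul_assoc, ← C_mul, inv_mul_cancel₀ hy0, C_1, one_mul, mul_one]]
    ring
  have hdvd : X - C y⁻¹ ∣ g.map (algebraMap K L) - C (aeval y⁻¹ g) := by
    rw [dvd_iff_isRoot]
    simp [IsRoot, aeval_def, eval_map]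
  obtain ⟨M, hM⟩ := hdvd
  have hHg : H * g.map (algebraMap K L) =
      aeval y⁻¹ g • H + (X ^ n - 1) * (C y⁻¹ * M) := by
    rw [smul_eq_C_mul]
    linear_combination H * hM + M * hHX
  have hpair := pairing_mul_eq_zero (L := L) hn hg hc H
  rw [hHg, map_add, map_smul] at hpair
  have hz : pairing c L ((X ^ n - 1) * (C y⁻¹ * M)) = 0 := by
    rw [pairing_apply, (modByMonic_eq_zero_iff_dvd hmon).2 (dvd_mul_right _ _)]
    simp
  rw [hz, add_zero, smul_eq_mul] at hpair
  have hpH := (mul_eq_zero.1 hpair).resolve_left hgy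
  have hHdeg : H.degree < (X ^ n - 1 : L[X]).degree := by
    rw [show (X ^ n - 1 : L[X]) = X ^ n - C 1 by simp, degree_X_pow_sub_C hn, hH]
    refine (degree_sum_le _ _).trans_lt ((Finset.sup_lt_iff (WithBot.bot_lt_coe n)).2 ?_)
    intro i hi
    rw [mul_pow, ← C_pow]
    exact (degree_C_mul_X_pow_le _ _).trans_lt (Nat.cast_lt.2 (Finset.mem_range.1 hi))
  rw [pairing_apply, (modByMonic_eq_self_iff hmon).2 hHdeg] at hpH
  rw [aeval_vecToPoly, ← hpH]
  refine Finset.sum_congr rfl fun i _ => ?_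
  congr 1
  rw [hH, finsetSum_coeff]
  simp only [mul_pow, ← C_pow, coeff_C_mul, coeff_X_pow]
  simp

/-- A cyclic code whose zeros are closed under inversion has complementary dual. -/
theorem isLCD_cyclicCode (hn : 0 < n) (hβ : IsPrimitiveRoot β n) {g : K[X]}
    (hg : g ∣ X ^ n - 1) (hinv : ∀ y : L, y ^ n = 1 → aeval y⁻¹ g = 0 → aeval y g = 0) :
    IsLCD (cyclicCode n g) := by
  classical
  rw [IsLCD, eq_bot_iff]
  rintro c ⟨hcC, hcD⟩
  rw [Submodule.mem_bot]
  by_contra hc0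
  -- At each n-th root of unity c vanishes, either through the code or through its dual. These n
  -- consecutive zeros would force weight n + 1.
  have := le_hammingNorm_of_consecutive_zeros (K := K) hβ hc0 0 (n + 1) fun k _ => by
    have hy : (β ^ (0 + k)) ^ n = 1 := by rw [← pow_mul, mul_comm, pow_mul, hβ.pow_eq_one, one_pow]
    by_cases h : aeval (β ^ (0 + k))⁻¹ g = 0
    · obtain ⟨a, ha⟩ := (mem_cyclicCode hg).1 hcC
      rw [ha, map_mul, hinv _ hy h, zero_mul]
    · exact aeval_vecToPoly_eq_zero_of_mem_dualCode hn hg hcD hy h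
  have h2 := hammingNorm_le_card_fintype (x := c)
  rw [Fintype.card_fin] at h2
  omega

theorem le_minDist_bchCode_one (hβ : IsPrimitiveRoot β n) {δ : ℕ}
    (hpos : 0 < Module.finrank K (bchCode K β n δ 1)) : δ ≤ minDist (bchCode K β n δ 1) :=
  le_minDist hpos fun c hc hc0 => le_hammingNorm_of_consecutive_zeros hβ hc0 1 δ fun k hk =>
    (mem_bchCode hβ).1 hc _ (Finset.mem_Ico.2 ⟨by omega, by omega⟩)

end Duality

theorem pow_pow_eq_inv {q n m : ℕ} {L : Type*} [Field L] (hn : n = q ^ m + 1) {y : L}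
    (hy : y ^ n = 1) : y ^ q ^ m = y⁻¹ := by
  rw [hn, pow_succ] at hy
  exact eq_inv_of_mul_eq_one_left hy

/-! ### Parameters of the BCH codes of length q^m + 1 -/

section Parameters

variable {K : Type*} [Field K] [Fintype K] {L : Type*} [Field L] [Algebra K L] {n m : ℕ} {β : L}

theorem aeval_inv_eq_zero (hn : n = Fintype.card K ^ m + 1) {y : L} (hy : y ^ n = 1) {p : K[X]}
    (h : aeval y p = 0) : aeval y⁻¹ p = 0 := by
  rw [← pow_pow_eq_inv hn hy, aeval_pow_card_pow, h, zero_pow]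
  exact pow_ne_zero _ Fintype.card_ne_zero

theorem isLCD_bchCode (hn : n = Fintype.card K ^ m + 1) (hβ : IsPrimitiveRoot β n) (δ b : ℕ) :
    IsLCD (bchCode K β n δ b) :=
  isLCD_cyclicCode (by omega) hβ (genPoly_dvd_X_pow_sub_one hβ δ b) fun y hy h => by
    have := aeval_inv_eq_zero hn (by rw [inv_pow, hy, inv_one]) h
    rwa [inv_inv] at this

theorem le_minDist_bchCode_zero (hn : n = Fintype.card K ^ m + 1) (hβ : IsPrimitiveRoot β n)
    {δ : ℕ} (hδ : δ ≤ n) (hpos : 0 < Module.finrank K (bchCode K β n (δ + 1) 0)) :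
    2 * δ ≤ minDist (bchCode K β n (δ + 1) 0) := by
  refine le_minDist hpos fun c hc hc0 =>
    -- Exponents n + 1 - δ, …, n + δ - 1: the zeros 0, …, δ - 1 together with their negatives, 2δ -
    -- 1 in a row.
    le_hammingNorm_of_consecutive_zeros hβ hc0 (n + 1 - δ) (2 * δ) fun k hk => ?_
  have hz : ∀ i < δ, aeval (β ^ i) (vecToPoly K n c) = 0 := fun i hi =>
    (mem_bchCode hβ).1 hc _ (Finset.mem_Ico.2 ⟨by omega, by omega⟩)
  rcases Nat.lt_or_ge (n + 1 - δ + k) n with h | h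
  · have h1 : (β ^ (δ - 1 - k)) ^ n = 1 := by
      rw [← pow_mul, mul_comm, pow_mul, hβ.pow_eq_one, one_pow]
    have h2 := aeval_inv_eq_zero hn h1 (hz (δ - 1 - k) (by omega))
    rwa [← eq_inv_of_mul_eq_one_left (a := β ^ (n + 1 - δ + k))] at h2
    rw [← pow_add, show n + 1 - δ + k + (δ - 1 - k) = n by omega, hβ.pow_eq_one]
  · obtain ⟨i, hi⟩ := Nat.exists_eq_add_of_le h
    rw [hi, pow_add, hβ.pow_eq_one, one_mul]
    exact hz i (by omega)

/-- The parameters of the two codes of designed distance `δ` when `k` residues have a leader of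
size at least `δ`. -/
theorem params_bchCode (hm : 0 < m) (hn : n = Fintype.card K ^ m + 1) (hβ : IsPrimitiveRoot β n)
    {δ d k : ℕ} (hδ0 : 0 < δ) (hδ : δ ≤ n) (hd : d ≤ δ) (hk0 : 0 < k)
    (hk : ((Finset.range n).filter fun j =>
      δ ≤ cosetLeader (Fintype.card K) n j).card = k) :
    (IsLCD (bchCode K β n δ 1) ∧ HasParams (bchCode K β n δ 1) (k + 1) d) ∧
    (IsLCD (bchCode K β n (δ + 1) 0) ∧ HasParams (bchCode K β n (δ + 1) 0) k (2 * d)) := by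
  have hn0 : 0 < n := by omega
  have hq := coprime_of_eq_pow_add_one hm hn
  have ho := orderOf_pos_of_coprime hn0 hq
  have hnK : (n : K) ≠ 0 := by
    rw [hn]
    push_cast
    rw [FiniteField.cast_card_eq_zero, zero_pow hm.ne', zero_add]
    exact one_ne_zero
  have h1 : Module.finrank K (bchCode K β n δ 1) = k + 1 := by
    rw [finrank_bchCode hn0 hnK hβ ho, Nat.add_sub_cancel_left,
      card_filter_notMem_one hn0 ho hq hδ0 hδ, hk]
  have h0 : Module.finrank K (bchCode K β n (δ + 1) 0) = k := by
    rw [finrank_bchCode hn0 hnK hβ ho, show 0 + (δ + 1) - 1 = δ by omega,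
      card_filter_notMem_zero hn0 ho, hk]
  exact ⟨⟨isLCD_bchCode hn hβ _ _, h1, hd.trans (le_minDist_bchCode_one hβ (by omega))⟩,
    isLCD_bchCode hn hβ _ _, h0,
    (Nat.mul_le_mul_left 2 hd).trans (le_minDist_bchCode_zero hn hβ hδ (by omega))⟩

end Parameters

end BCH

theorem theorem1 (q t m n : ℕ) (hq : Even q) (hm : m = 4 * t + 2) (hn : n = q ^ m + 1)
    (K : Type*) [Field K] [Fintype K] (hK : Fintype.card K = q)
    (L : Type*) [Field L] [Algebra K L] (β : L) (hβ : IsPrimitiveRoot β n) :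
    (∀ δ₁ δ₂ : ℕ, BCH.IsIthLargestCosetLeader q n 1 δ₁ → BCH.IsIthLargestCosetLeader q n 2 δ₂ →
      ∀ δ : ℕ, δ₂ + 1 ≤ δ → δ ≤ δ₁ →
        (BCH.IsLCD (BCH.bchCode K β n δ 1) ∧
          BCH.HasParams (BCH.bchCode K β n δ 1) 5 δ₂) ∧
        (BCH.IsLCD (BCH.bchCode K β n (δ + 1) 0) ∧
          BCH.HasParams (BCH.bchCode K β n (δ + 1) 0) 4 (2 * δ₂))) ∧
    (∀ δ₂ δ₃ : ℕ, BCH.IsIthLargestCosetLeader q n 2 δ₂ → BCH.IsIthLargestCosetLeader q n 3 δ₃ →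
      ∀ δ : ℕ, δ₃ + 1 ≤ δ → δ ≤ δ₂ →
        (BCH.IsLCD (BCH.bchCode K β n δ 1) ∧
          BCH.HasParams (BCH.bchCode K β n δ 1) (2 * m + 5) δ₃) ∧
        (BCH.IsLCD (BCH.bchCode K β n (δ + 1) 0) ∧
          BCH.HasParams (BCH.bchCode K β n (δ + 1) 0) (2 * m + 4) (2 * δ₃))) := by
  obtain ⟨h, hqh⟩ := hq
  rw [← two_mul] at hqh
  have hh : 0 < h := by
    have : 0 < Fintype.card K := Fintype.card_pos
    omega
  have hm0 : 0 < m := by omega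
  have hn0 : 0 < n := by omega
  have ho := BCH.orderOf_pos_of_coprime hn0 (BCH.coprime_of_eq_pow_add_one hm0 hn)
  subst hK
  rw [hqh] at hn ho ⊢
  constructor
  · intro δ₁ δ₂ h1 h2 δ hlo hhi
    have h1n := ((BCH.mem_minRep hn0 ho).1 h1.1).1
    refine BCH.params_bchCode hm0 (hqh ▸ hn) hβ (by omega) (by omega) (by omega) (by norm_num) ?_
    rw [hqh, BCH.filter_leader_eq_coset hn0 ho h1.1 (h1.le_iff_second h2 hlo hhi)]
    exact BCH.card_largest hh hm hn h1
  · intro δ₂ δ₃ h2 h3 δ hlo hhi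
    have h2n := ((BCH.mem_minRep hn0 ho).1 h2.1).1
    -- Two cosets have leader at least δ, those of δ₁ and δ₂, with 4 + 2m residues in all.
    obtain ⟨δ₁, h1, h12, -⟩ := h2.exists_largest
    refine BCH.params_bchCode hm0 (hqh ▸ hn) hβ (by omega) (by omega) (by omega) (by omega) ?_
    rw [hqh, BCH.card_filter_leader_pair hn0 ho h1.1 h2.1 (by omega)
      (h1.le_iff_third h2 h3 h12 hlo hhi), BCH.card_largest hh hm hn h1,
      BCH.card_second hh hm hn h2 (by omega)]
    ring
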